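/- Setting. A state $\omega\in\Omega=[0,1]$ is distributed according to $F$, which has a density $f\ge 0$ with respect to Lebesgue measure. A receiver has a type $\theta\in\Theta=\{1,\dots,n\}$, independent of $\omega$, with $\Pr(\theta)=g(\theta)>0$. The receiver chooses an action $a$ from a non-empty compact set $A$. The receiver's and the designer's utilities are quasi-linear in the state: $$u(a,\omega,\theta)=u_1(a,\theta)\,\omega+u_2(a,\theta),\qquad v(a,\omega,\theta)=v_1(a,\theta)\,\omega+v_2(a,\theta),$$ with $u_1,u_2,v_1,v_2$ continuous in $a$. A signal $\mu$ assigns to each state $\omega$ a probability distribution $\mu(\cdot\mid\omega)$ on a measurable space $S$ of messages; $\mathbb{E}_\mu[\,\cdot\mid s]$ denotes expectation under the posterior (regular conditional) distribution of $\omega$ given the message $s$. A mechanism is a set (menu) $M$ of signals. A receiver strategy consists, for each type $\theta$, of a signal $\mu^\theta\in M$ and of an action $a^\theta(s)$ for each message $s$ (depending measurably on $s$). It is optimal in $M$ if, for every $\theta$, $a^\theta(s)\in\arg\max_{b\in A}\mathbb{E}_{\mu^\theta}[u(b,\omega,\theta)\mid s]$ for almost every message $s$ and $$\mu^\theta\in\arg\max_{\nu\in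 M}\int_\Omega\int_S\max_{b\in A}\mathbb{E}_\nu[u(b,\omega,\theta)\mid s]\,d\nu(s\mid\omega)\,dF(\omega).$$ The designer chooses a mechanism $M$ and a receiver strategy that is optimal in $M$ to maximize $$\sum_{\theta\in\Theta}g(\theta)\int_\Omega\int_S\mathbb{E}_{\mu^\theta}[v(a^\theta(s),\omega,\theta)\mid s]\,d\mu^\theta(s\mid\omega)\,dF(\omega);$$ a maximizing mechanism, together with the strategy, is called optimal. A signal is partitional if there are sets $(P_s)_{s\in S}$ that partition $\Omega$ (empty sets allowed) with $\mu(\{s\}\mid\omega)=\mathbf 1_{\omega\in P_s}$ for all $s,\omega$, where $S$ is a standard Borel space. It is laminar partitional if moreover $\mathrm{cx}\,P_s\cap \mathrm{cx}\,P_{s'}\in\{\emptyset,\mathrm{cx}\,P_s,\mathrm{cx}\,P_{s'}\}$ for all $s,s'$, where $\mathrm{cx}$ denotes the convex hull. Write $P(\omega)$ for the element of the partition that contains $\omega$. Theorem. There exists an optimal mechanism, consisting of one signal $\mu^\theta$ for each type $\theta$, in which the signal $\mu^\theta$ observed by each type $\theta$ is laminar partitional, with a partition $P^\theta=(P^\theta_s)_s$.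 Furthermore, for each type $\theta$ there exists a countable collection of intervals $I^\theta_1,I^\theta_2,\dots\subseteq\Omega$ such that (i) $\omega\notin\bigcup_k I^\theta_k$ implies $P^\theta(\omega)=\{\omega\}$; (ii) $\omega\in I^\theta_k$ implies $P^\theta(\omega)\subseteq I^\theta_k$, and in $I^\theta_k$ at most $n+2$ distinct messages are sent, i.e. $|\{s : P^\theta_s\cap I^\theta_k\neq\emptyset\}|\le n+2$. -/

import Mathlib

open MeasureTheory ProbabilityTheory
open scoped unitInterval NNReal ENNReal

universe uA uS

noncomputable section

namespace Persuasion

/-- A signal (Blackwell experiment) about the state `ω ∈ [0,1]`: a measurable space of messages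
and, for every state, a conditional distribution over messages. -/
structure Signal where
  /-- the message space `S` -/
  Msg : Type uS
  [measurableSpace : MeasurableSpace Msg]
  /-- the conditional distribution `μ(· | ω)` of the message given the state -/
  kernel : Kernel I Msg
  [isMarkov : IsMarkovKernel kernel]

attribute [instance] Signal.measurableSpace Signal.isMarkov

namespace Signal

variable (μ : Signal.{uS}) (F : Measure I) [IsFiniteMeasure F]

/-- The unconditional distribution of the message of `μ` when the state has distribution `F`. -/
def law : Measure μ.Msg := μ.kernel ∘ₘ F

/-- The posterior distribution of the state after the message `s` of the signal `μ`, given by the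
regular conditional distribution of the state given the message. -/
def belief (s : μ.Msg) : Measure I := (μ.kernel†F) s

/-- The posterior expectation `E_μ[φ(ω) | s]`. -/
def expect (φ : I → ℝ) (s : μ.Msg) : ℝ := ∫ ω, φ ω ∂(μ.belief F s)

/-- The value `∫ max_{b ∈ A} E_μ[w(b, ω) | s]` of observing the signal `μ` before choosing an action
for an agent with utility `w`. -/
def value {A : Type uA} (w : A → I → ℝ) : ℝ :=
  ∫ s, (⨆ b : A, μ.expect F (w b) s) ∂(μ.law F)

end Signal

/-- Utility functions (of action, state and type) that are quasi-linear in the state, with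
coefficients continuous in the action. -/
def QuasiLinear {A : Type uA} [TopologicalSpace A] {n : ℕ} (u : A → I → Fin n → ℝ) : Prop :=
  ∃ u₁ u₂ : A → Fin n → ℝ,
    (∀ θ, Continuous fun a => u₁ a θ) ∧ (∀ θ, Continuous fun a => u₂ a θ) ∧
    ∀ a ω θ, u a ω θ = u₁ a θ * (ω : ℝ) + u₂ a θ

/-- A strategy of the receiver: the signal `μ^θ` chosen by each type `θ` and the action `a^θ(s)`
that this type takes after each message `s` of that signal. -/
structure Strategy (A : Type uA) (n : ℕ) where
  /-- the signal chosen by each type -/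
  signal : Fin n → Signal.{uS}
  /-- the action taken by each type after each message -/
  action : ∀ θ, (signal θ).Msg → A

/-- The strategy `τ` is optimal for the receiver in the mechanism (menu of signals) `M`.
The fields `measurable_u` and `measurable_v` say that the action depends on the message in a
measurable way as far as payoffs are concerned, so that expected payoffs are well defined. -/
structure Strategy.IsOptimal {A : Type uA} {n : ℕ} (F : Measure I) [IsFiniteMeasure F]
    (u v : A → I → Fin n → ℝ) (M : Set Signal.{uS}) (τ : Strategy.{uA, uS} A n) : Prop where
  measurable_u : ∀ θ ω, Measurable fun s => u (τ.action θ s) ω θ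
  measurable_v : ∀ θ ω, Measurable fun s => v (τ.action θ s) ω θ
  /-- the chosen signals are on the menu -/
  mem : ∀ θ, τ.signal θ ∈ M
  /-- actions are optimal after almost every message -/
  opt_act : ∀ θ, ∀ᵐ s ∂((τ.signal θ).law F), ∀ b : A,
    (τ.signal θ).expect F (fun ω => u b ω θ) s ≤
      (τ.signal θ).expect F (fun ω => u (τ.action θ s) ω θ) s
  /-- every type chooses a signal of the menu that is best for him -/
  opt_signal : ∀ θ, ∀ ν ∈ M,
    ν.value F (fun b ω => u b ω θ) ≤ (τ.signal θ).value F (fun b ω => u b ω θ)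

/-- The expected utility of the designer with utility `v` when the type has distribution `g`, is
independent of the state, and the receiver uses the strategy `τ`. -/
def designerPayoff {A : Type uA} {n : ℕ} (F : Measure I) [IsFiniteMeasure F] (g : Fin n → ℝ)
    (v : A → I → Fin n → ℝ) (τ : Strategy.{uA, uS} A n) : ℝ :=
  ∑ θ, g θ * ∫ s, (τ.signal θ).expect F (fun ω => v (τ.action θ s) ω θ) s ∂((τ.signal θ).law F)

/-- The mechanism `M` together with the receiver's strategy `τ`, optimal in `M`, maximizes the
designer's expected utility among all mechanisms and optimal strategies in them. -/
def IsOptimalMechanism {A : Type uA} {n : ℕ} (F : Measure I) [IsFiniteMeasure F] (g : Fin n → ℝ)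
    (u v : A → I → Fin n → ℝ) (M : Set Signal.{uS}) (τ : Strategy.{uA, uS} A n) : Prop :=
  τ.IsOptimal F u v M ∧
    ∀ (M' : Set Signal.{uS}) (τ' : Strategy.{uA, uS} A n), τ'.IsOptimal F u v M' →
      designerPayoff F g v τ' ≤ designerPayoff F g v τ

/-- The convex hull in `ℝ` of a set of states. -/
def cx (P : Set I) : Set ℝ := convexHull ℝ (Subtype.val '' P)

/-- The signal `μ` is partitional with partition `P`: the sets `P s` partition the states (`P s` is
empty for a message that is never sent), and message `s` is sent for sure in the states of `P s`
and only there. The message space is standard Borel, so that observing the message is the same as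
learning the partition element. -/
structure Signal.IsPartitional (μ : Signal.{uS}) (P : μ.Msg → Set I) : Prop where
  standardBorel : StandardBorelSpace μ.Msg
  disjoint : Pairwise fun s t => Disjoint (P s) (P t)
  cover : ⋃ s, P s = Set.univ
  kernel_singleton : ∀ s ω, μ.kernel ω {s} = (P s).indicator (fun _ => (1 : ℝ≥0∞)) ω

/-- A family of sets of states is laminar if the convex hulls of any two of its members are nested
or disjoint. -/
def IsLaminar {S : Type uS} (P : S → Set I) : Prop :=
  ∀ s t, cx (P s) ∩ cx (P t) = ∅ ∨ cx (P s) ∩ cx (P t) = cx (P s) ∨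
    cx (P s) ∩ cx (P t) = cx (P t)

/-- The set of states in which the same message is sent as in state `ω`. -/
def cell {S : Type uS} (P : S → Set I) (ω : I) : Set I :=
  {ω' | ∃ s, ω ∈ P s ∧ ω' ∈ P s}

end Persuasion

end

/-!
Utilities are affine in the state, so a message matters only through the posterior mean it
induces, and a signal only through the law `G` of its posterior mean. By Jensen's inequality `G`
is a mean-preserving contraction of `F` (`Signal.convexOrder_meanLaw`). The designer therefore
chooses one contraction `G θ` of `F` for each type. The indirect utility `U θ` of a type is
continuous in the posterior mean, and incentive compatibility says that
`∫ U θ ∂(G θ') ≤ ∫ U θ ∂(G θ)`. With ties broken in the designer's favour, the designer's payoff `V θ` is upper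
semicontinuous (`exists_measurable_argmax`). Laws on a compact space form a compact space, so an
optimum exists.

The optimum is taken to be an extreme point of the set of optima (`exists_optimal_extremal`).
Consider an interval on which the integrated distribution function of `G θ` stays below that of
`F`, that is, a gap of the contact set. If `G θ` had more than `n + 2` points of support there,
its mass near these points could be shifted in two opposite directions without changing its mass,
its mean or any of the `n` integrals of the `U η`, and hence without violating a constraint
(`ConvexOrder.exists_perturbation`). So `G θ` has at most `n + 2` atoms on each gap. At points of
contact, distribution functions and first moments of `G θ` and `F` agree, so that the gaps can be
treated one by one, and off the gaps the state is revealed.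

On a gap, the atoms are implemented in turn. Since `F` has no atoms, some interval has the mass
and mean of a given atom (`ConvexOrder.exists_Ioc`), and what remains of `G` is a contraction of
what remains of `F` (`ConvexOrder.restrict_compl`). The cell of an atom is its interval minus all
earlier ones. An interval contained in the union of the earlier cells is missed by every later
cell, whose convex hull hence contains it or is disjoint from it, and this is laminarity
(`ConvexOrder.exists_laminar_map`, `Separated.cx_inter`). Messages are posterior means, so a cell
is a fibre of the map `T` from states to posterior means (`ConvexOrder.exists_partition_map`,
`Signal.ofMap`).
-/

noncomputable section

namespace Persuasion

/-! ### The convex order of measures on the unit interval -/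

lemma integrable_of_continuous (G : Measure I) [IsFiniteMeasure G] {φ : I → ℝ}
    (h : Continuous φ) : Integrable φ G :=
  h.integrable_of_hasCompactSupport (HasCompactSupport.of_compactSpace φ)

lemma integrable_coe (G : Measure I) [IsFiniteMeasure G] : Integrable (fun ω : I => (ω : ℝ)) G :=
  integrable_of_continuous G continuous_subtype_val

lemma continuous_hockey (x : ℝ) : Continuous fun ω : I => max (x - (ω : ℝ)) 0 := by fun_prop

lemma integrable_hockey (G : Measure I) [IsFiniteMeasure G] (x : ℝ) :
    Integrable (fun ω : I => max (x - (ω : ℝ)) 0) G :=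
  integrable_of_continuous G (continuous_hockey x)

/-- The integrated distribution function `x ↦ ∫ (x - ω)⁺ dG` of `G`; it is convex with right
derivative the distribution function of `G`. -/
def icdf (G : Measure I) (x : ℝ) : ℝ := ∫ ω, max (x - (ω : ℝ)) 0 ∂G

/-- `G` is a mean-preserving contraction of `F`. For measures on the line it suffices to test
the convex order on the functions `ω ↦ (x - ω)⁺`; the masses need not be one, so that
the relation can be restricted to parts of the state space. -/
structure ConvexOrder (G F : Measure I) : Prop where
  mass : G.real Set.univ = F.real Set.univ
  mean : ∫ ω, (ω : ℝ) ∂G = ∫ ω, (ω : ℝ) ∂F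
  le : ∀ x : ℝ, icdf G x ≤ icdf F x

/-! ### Separated sets -/

/-- Some interval contains one of the two sets and misses the other one. This implies
that their convex hulls are nested or disjoint, and unlike that property it passes to subsets. -/
def Separated (P Q : Set I) : Prop :=
  ∃ K : Set I, K.OrdConnected ∧ ((P ⊆ K ∧ Disjoint Q K) ∨ (Q ⊆ K ∧ Disjoint P K))

lemma Separated.symm {P Q : Set I} (h : Separated P Q) : Separated Q P := by
  obtain ⟨K, hK, h | h⟩ := h
  exacts [⟨K, hK, Or.inr h⟩, ⟨K, hK, Or.inl h⟩]

lemma Separated.mono {P Q P' Q' : Set I} (h : Separated P Q) (hP : P' ⊆ P) (hQ : Q' ⊆ Q) :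
    Separated P' Q' := by
  obtain ⟨K, hK, h | h⟩ := h
  · exact ⟨K, hK, Or.inl ⟨hP.trans h.1, h.2.mono_left hQ⟩⟩
  · exact ⟨K, hK, Or.inr ⟨hQ.trans h.1, h.2.mono_left hP⟩⟩

lemma cx_inter_of_disjoint_ordConnected {P Q K : Set I} (hK : K.OrdConnected) (hP : P ⊆ K)
    (hQ : Disjoint Q K) : cx P ∩ cx Q = ∅ ∨ cx P ∩ cx Q = cx P := by
  rcases (cx P ∩ cx Q).eq_empty_or_nonempty with h | ⟨z, hzP, hzQ⟩
  · exact Or.inl h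
  right
  rw [Set.inter_eq_left]
  have out : ∀ q ∈ Q, ∀ p ∈ P, ∀ p' ∈ P, p ≤ q → q ≤ p' → False := fun q hq p hp p' hp' h1 h2 =>
    Set.disjoint_left.1 hQ hq (hK.out (hP hp) (hP hp') ⟨h1, h2⟩)
  have conv : ∀ S : Set ℝ, Convex ℝ S → ∀ X : Set I, Subtype.val '' X ⊆ S → cx X ⊆ S :=
    fun S hS X hX => convexHull_min hX hS
  -- some point of `Q` lies below every point of `P`, since otherwise all of `Q` lies above `P`
  have below : ∃ q ∈ Q, ∀ p ∈ P, q ≤ p := by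
    by_contra! hcon
    have habove : ∀ q ∈ Q, ∀ p ∈ P, p < q := by
      intro q hq p hp
      obtain ⟨p', hp', hlt⟩ := hcon q hq
      by_contra! hle
      exact out q hq p' hp' p hp hlt.le hle
    by_cases hex : ∃ p ∈ P, z ≤ (p : ℝ)
    · obtain ⟨p, hp, hzp⟩ := hex
      have := conv _ (convex_Ioi (p : ℝ)) Q (by
        rintro _ ⟨q, hq, rfl⟩; exact habove q hq p hp) hzQ
      exact absurd hzp (not_le.2 this)
    · push Not at hex
      exact lt_irrefl z (conv _ (convex_Iio z) P (by rintro _ ⟨p, hp, rfl⟩; exact hex p hp) hzP)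
  have above : ∃ q ∈ Q, ∀ p ∈ P, p ≤ q := by
    by_contra! hcon
    have hbelow : ∀ q ∈ Q, ∀ p ∈ P, q < p := by
      intro q hq p hp
      obtain ⟨p', hp', hlt⟩ := hcon q hq
      by_contra! hle
      exact out q hq p hp p' hp' hle hlt.le
    by_cases hex : ∃ p ∈ P, (p : ℝ) ≤ z
    · obtain ⟨p, hp, hzp⟩ := hex
      have := conv _ (convex_Iio (p : ℝ)) Q (by
        rintro _ ⟨q, hq, rfl⟩; exact hbelow q hq p hp) hzQ
      exact absurd hzp (not_le.2 this)
    · push Not at hex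
      exact lt_irrefl z (conv _ (convex_Ioi z) P (by rintro _ ⟨p, hp, rfl⟩; exact hex p hp) hzP)
  obtain ⟨q, hq, hqP⟩ := below
  obtain ⟨q', hq', hqP'⟩ := above
  refine conv _ (convex_convexHull ℝ _) P ?_
  rintro _ ⟨p, hp, rfl⟩
  exact (convex_convexHull ℝ (Subtype.val '' Q)).ordConnected.out
    (subset_convexHull ℝ _ (Set.mem_image_of_mem _ hq))
    (subset_convexHull ℝ _ (Set.mem_image_of_mem _ hq')) ⟨hqP p hp, hqP' p hp⟩

/-- A set that misses the interval `K` either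
lies on one side of `K` or has points on both sides of it. -/
lemma Separated.cx_inter {P Q : Set I} (h : Separated P Q) :
    cx P ∩ cx Q = ∅ ∨ cx P ∩ cx Q = cx P ∨ cx P ∩ cx Q = cx Q := by
  obtain ⟨K, hK, h | h⟩ := h
  · exact (cx_inter_of_disjoint_ordConnected hK h.1 h.2).imp_right Or.inl
  · rw [Set.inter_comm]
    exact (cx_inter_of_disjoint_ordConnected hK h.1 h.2).imp_right Or.inr

/-! ### Splitting off one atom -/

lemma continuous_real_Iic (F : Measure I) [IsFiniteMeasure F] [NullSingletonClass F] :
    Continuous fun a : I => F.real (Set.Iic a) := by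
  have : (fun a : I => F.real (Set.Iic a)) =
      fun a => ∫ ω, (Set.Iic a).indicator (fun _ => (1 : ℝ)) ω ∂F := by
    ext a; rw [integral_indicator measurableSet_Iic]; simp
  rw [this, continuous_iff_continuousAt]
  intro a
  refine continuousAt_of_dominated (bound := fun _ => 1) ?_ ?_ (integrable_const _) ?_
  · exact .of_forall fun x => (measurable_const.indicator measurableSet_Iic).aestronglyMeasurable
  · refine .of_forall fun x => .of_forall fun ω => ?_
    by_cases h : ω ∈ Set.Iic x <;> simp [h]
  · have : ∀ᵐ ω ∂F, ω ≠ a := by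
      simp [ae_iff, measure_singleton]
    filter_upwards [this] with ω hω
    rcases lt_or_gt_of_ne hω with h | h
    · refine (continuousAt_const (y := (1:ℝ))).congr ?_
      filter_upwards [lt_mem_nhds h] with x hx
      simp [Set.indicator, hx.le]
    · refine (continuousAt_const (y := (0:ℝ))).congr ?_
      filter_upwards [gt_mem_nhds h] with x hx
      simp [Set.indicator, hx.not_ge]

lemma exists_real_Iic_eq (F : Measure I) [IsFiniteMeasure F] [NullSingletonClass F] {t : ℝ}
    (h0 : 0 ≤ t)
    (h1 : t ≤ F.real Set.univ) : ∃ a : I, F.real (Set.Iic a) = t := by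
  have := intermediate_value_univ (0 : I) 1 (continuous_real_Iic F)
  have e0 : Set.Iic (0 : I) = {0} := by ext x; simp
  have e1 : Set.Iic (1 : I) = Set.univ := by ext x; simp [unitInterval.le_one']
  apply this
  rw [e0, e1]
  simp [measureReal_def, h0]
  simpa [measureReal_def] using h1

lemma setIntegral_coe_le (F : Measure I) [IsFiniteMeasure F] (S : Set I) :
    ∫ ω in S, (ω : ℝ) ∂F ≤ F.real S := by
  calc ∫ ω in S, (ω : ℝ) ∂F ≤ ∫ ω in S, (1 : ℝ) ∂F :=
        integral_mono (integrable_coe _) (integrable_const _) fun ω => ω.2.2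
    _ = F.real S := by simp

lemma setIntegral_coe_nonneg (F : Measure I) (S : Set I) : 0 ≤ ∫ ω in S, (ω : ℝ) ∂F :=
  integral_nonneg fun ω => ω.2.1

lemma setIntegral_coe_eq_zero (F : Measure I) [IsFiniteMeasure F] {S : Set I} (h : F.real S = 0) :
    ∫ ω in S, (ω : ℝ) ∂F = 0 :=
  le_antisymm ((setIntegral_coe_le F S).trans h.le) (setIntegral_coe_nonneg F S)

lemma setIntegral_Ioc (F : Measure I) [IsFiniteMeasure F] {φ : I → ℝ} (h : Integrable φ F)
    {a b : I} (hab : a ≤ b) :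
    ∫ ω in Set.Ioc a b, φ ω ∂F = ∫ ω in Set.Iic b, φ ω ∂F - ∫ ω in Set.Iic a, φ ω ∂F := by
  rw [← Set.Iic_union_Ioc_eq_Iic hab, setIntegral_union _ measurableSet_Ioc h.integrableOn
    h.integrableOn]
  · ring
  · exact Set.disjoint_left.2 fun x hx hx' => not_lt.2 hx hx'.1

lemma real_Ioc (F : Measure I) [IsFiniteMeasure F] {a b : I} (hab : a ≤ b) :
    F.real (Set.Ioc a b) = F.real (Set.Iic b) - F.real (Set.Iic a) := by
  simpa using setIntegral_Ioc F (integrable_const (1 : ℝ)) hab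

lemma integral_const_sub (G : Measure I) [IsFiniteMeasure G] (x : ℝ) :
    ∫ ω, (x - (ω : ℝ)) ∂G = x * G.real Set.univ - ∫ ω, (ω : ℝ) ∂G := by
  rw [integral_sub (integrable_const _) (integrable_coe _)]
  simp [mul_comm]

lemma icdf_eq (G : Measure I) [IsFiniteMeasure G] (x : I) :
    icdf G x = x * G.real (Set.Iic x) - ∫ ω in Set.Iic x, (ω : ℝ) ∂G := by
  have h1 : icdf G x = ∫ ω in Set.Iic x, ((x : ℝ) - ω) ∂G := by
    rw [icdf, ← integral_indicator measurableSet_Iic]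
    congr 1; ext ω
    by_cases h : ω ≤ x
    · simp [Set.indicator, h]
    · simp [Set.indicator, h, (not_le.1 h).le]
  rw [h1, integral_sub (integrable_const _) (integrable_coe _)]
  simp [mul_comm]

lemma integral_restrict_compl_singleton (G : Measure I) [IsFiniteMeasure G] (m : I) {φ : I → ℝ}
    (h : Continuous φ) : ∫ ω in {m}ᶜ, φ ω ∂G = ∫ ω, φ ω ∂G - G.real {m} * φ m := by
  rw [← integral_add_compl (measurableSet_singleton m) (integrable_of_continuous G h)]
  simp [measureReal_def]

/-- If `G` is a mean-preserving contraction of the atomless measure `F`, then every atom of `G`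
can be spread out over an interval, with the same mass and mean under `F`: such an interval is
found among those of the given mass by the intermediate value theorem. -/
lemma ConvexOrder.exists_Ioc {G F : Measure I} [IsFiniteMeasure G] [IsFiniteMeasure F]
    [NullSingletonClass F]
    (h : ConvexOrder G F) (m : I) : ∃ a b : I, a ≤ b ∧ F.real (Set.Ioc a b) = G.real {m} ∧
      ∫ ω in Set.Ioc a b, (ω : ℝ) ∂F = m * G.real {m} := by
  set p := G.real {m} with hp
  set c := F.real Set.univ with hc
  have hp0 : 0 ≤ p := measureReal_nonneg
  have hpc : p ≤ c := by rw [hc, ← h.mass]; exact measureReal_mono (Set.subset_univ _)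
  have hex : ∀ t : ℝ, ∃ a : I, t ∈ Set.Icc 0 c → F.real (Set.Iic a) = t := fun t => by
    by_cases ht : t ∈ Set.Icc 0 c
    · obtain ⟨a, ha⟩ := exists_real_Iic_eq F ht.1 ht.2
      exact ⟨a, fun _ => ha⟩
    · exact ⟨0, fun h => absurd h ht⟩
  choose q hq using hex
  have hmono : ∀ s ∈ Set.Icc 0 c, ∀ t ∈ Set.Icc 0 c, s ≤ t → q s ≤ q t := by
    intro s hs t ht hst
    by_contra! hlt
    have := measureReal_mono (μ := F) (Set.Iic_subset_Iic.2 hlt.le)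
    rw [hq s hs, hq t ht] at this
    exact hlt.ne (by rw [le_antisymm hst this])
  -- `L (t + p) - L t` is the first moment of the interval between the quantiles `t` and `t + p`;
  -- quantiles may jump over gaps in the support, but `L` is Lipschitz
  set L : ℝ → ℝ := fun t => ∫ ω in Set.Iic (q t), (ω : ℝ) ∂F with hL
  have hLdiff : ∀ s ∈ Set.Icc 0 c, ∀ t ∈ Set.Icc 0 c, s ≤ t → |L t - L s| ≤ |t - s| := by
    intro s hs t ht hst
    have h1 := setIntegral_Ioc F (integrable_coe F) (hmono s hs t ht hst)
    have h2 := real_Ioc F (hmono s hs t ht hst)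
    rw [hq s hs, hq t ht] at h2
    have h3 := setIntegral_coe_le F (Set.Ioc (q s) (q t))
    have h4 := setIntegral_coe_nonneg F (Set.Ioc (q s) (q t))
    rw [abs_of_nonneg (by simp only [hL]; linarith), abs_of_nonneg (by linarith)]
    simp only [hL]; linarith
  have hLlip : LipschitzOnWith 1 L (Set.Icc 0 c) := by
    refine LipschitzOnWith.of_dist_le_mul fun s hs t ht => ?_
    rw [Real.dist_eq, Real.dist_eq, NNReal.coe_one, one_mul]
    rcases le_total s t with hst | hst
    · rw [abs_sub_comm, abs_sub_comm s]; exact hLdiff s hs t ht hst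
    · exact hLdiff t ht s hs hst
  have hcont : ContinuousOn (fun t => L (t + p) - L t) (Set.Icc 0 (c - p)) := by
    refine ContinuousOn.sub ?_ (hLlip.continuousOn.mono (Set.Icc_subset_Icc_right (by linarith)))
    refine hLlip.continuousOn.comp (by fun_prop) fun t ht => ⟨?_, ?_⟩ <;> linarith [ht.1, ht.2]
  -- the lowest interval of mass `p` has mean at most `m`
  have hleft : L (0 + p) - L 0 ≤ m * p := by
    have h0 : L 0 = 0 := setIntegral_coe_eq_zero F (hq 0 ⟨le_rfl, hp0.trans hpc⟩)
    rw [h0, zero_add, sub_zero]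
    have h1 := h.le (q p)
    rw [icdf_eq F, hq p ⟨hp0, hpc⟩] at h1
    have h2 : p * max ((q p : ℝ) - m) 0 ≤ icdf G (q p) := by
      have := integral_restrict_compl_singleton G m (continuous_hockey (q p))
      have h3 : 0 ≤ ∫ ω in {m}ᶜ, max ((q p : ℝ) - (ω : ℝ)) 0 ∂G :=
        integral_nonneg fun ω => le_max_right _ _
      simp only [icdf]; linarith
    have h4 := mul_le_mul_of_nonneg_left (le_max_left ((q p : ℝ) - m) 0) hp0
    simp only [hL]; linarith
  -- the highest interval of mass `p` has mean at least `m`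
  have hright : m * p ≤ L (c - p + p) - L (c - p) := by
    have hc' : c - p ∈ Set.Icc 0 c := ⟨by linarith, by linarith⟩
    have h0 : L c = ∫ ω, (ω : ℝ) ∂F := by
      have := integral_add_compl (μ := F) (s := Set.Iic (q c)) measurableSet_Iic (integrable_coe F)
      rw [setIntegral_coe_eq_zero F (S := (Set.Iic (q c))ᶜ), add_zero] at this
      · exact this
      · rw [measureReal_compl measurableSet_Iic, hq c ⟨hp0.trans hpc, le_rfl⟩, ← hc, sub_self]
    rw [sub_add_cancel, h0, ← h.mean]
    have h1 := h.le (q (c - p))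
    rw [icdf_eq F, hq _ hc'] at h1
    have h2 := integral_restrict_compl_singleton G m (continuous_hockey (q (c - p)))
    have h3 := integral_restrict_compl_singleton G m
      (φ := fun ω : I => (q (c - p) : ℝ) - ω) (by fun_prop)
    have h4 : ∫ ω in {m}ᶜ, ((q (c - p) : ℝ) - (ω : ℝ)) ∂G ≤
        ∫ ω in {m}ᶜ, max ((q (c - p) : ℝ) - (ω : ℝ)) 0 ∂G :=
      integral_mono (integrable_of_continuous _ (by fun_prop)) (integrable_hockey _ _)
        fun ω => le_max_left _ _
    rw [integral_const_sub G, h.mass, ← hc] at h3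
    have h5 : 0 ≤ p * max ((q (c - p) : ℝ) - m) 0 := mul_nonneg hp0 (le_max_right _ _)
    simp only [icdf, hL] at *
    linarith
  obtain ⟨t, ht, hteq⟩ := intermediate_value_Icc (by linarith) hcont ⟨hleft, hright⟩
  have ht1 : t ∈ Set.Icc 0 c := ⟨ht.1, by linarith [ht.2]⟩
  have ht2 : t + p ∈ Set.Icc 0 c := ⟨by linarith [ht.1], by linarith [ht.2]⟩
  have hle := hmono t ht1 (t + p) ht2 (by linarith)
  refine ⟨q t, q (t + p), hle, ?_, ?_⟩
  · rw [real_Ioc F hle, hq _ ht1, hq _ ht2]; ring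
  · rw [setIntegral_Ioc F (integrable_coe F) hle]; exact hteq

/-- After an atom of `G` and an interval with the same mass and mean under `F` are removed, the rest
of `G` is still a mean-preserving contraction of the rest of `F`. -/
lemma ConvexOrder.restrict_compl {G F : Measure I} [IsFiniteMeasure G] [IsFiniteMeasure F]
    (h : ConvexOrder G F) {m a b : I} (hmass : F.real (Set.Ioc a b) = G.real {m})
    (hmean : ∫ ω in Set.Ioc a b, (ω : ℝ) ∂F = m * G.real {m}) :
    ConvexOrder (G.restrict {m}ᶜ) (F.restrict (Set.Ioc a b)ᶜ) := by
  have hF : ∀ {φ : I → ℝ}, Continuous φ → ∫ ω in (Set.Ioc a b)ᶜ, φ ω ∂F =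
      ∫ ω, φ ω ∂F - ∫ ω in Set.Ioc a b, φ ω ∂F := fun hφ => by
    rw [← integral_add_compl measurableSet_Ioc (integrable_of_continuous F hφ)]; ring
  have hG := fun (φ : I → ℝ) (hφ : Continuous φ) => integral_restrict_compl_singleton G m hφ
  -- the inequality for functions `(x - ω)⁺` whose kink is not interior to the interval removed
  have key : ∀ x : ℝ, (x ≤ a ∨ (b : ℝ) ≤ x) →
      icdf (G.restrict {m}ᶜ) x ≤ icdf (F.restrict (Set.Ioc a b)ᶜ) x := by
    intro x hx
    have h1 : ∫ ω in Set.Ioc a b, max (x - (ω : ℝ)) 0 ∂F ≤ G.real {m} * max (x - (m : ℝ)) 0 := by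
      rcases hx with hx | hx
      · rw [setIntegral_congr_fun (g := fun _ => (0 : ℝ)) measurableSet_Ioc]
        · simpa using mul_nonneg measureReal_nonneg (le_max_right _ _)
        · intro ω hω
          have : (a : ℝ) < ω := hω.1
          exact max_eq_right (by linarith)
      · rw [setIntegral_congr_fun (g := fun ω : I => x - (ω : ℝ)) measurableSet_Ioc]
        · rw [integral_const_sub, measureReal_restrict_apply_univ, hmass, hmean]
          have := mul_le_mul_of_nonneg_left (le_max_left (x - (m : ℝ)) 0)
            (measureReal_nonneg (μ := G) (s := {m}))
          linarith
        · intro ω hω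
          have : (ω : ℝ) ≤ b := hω.2
          exact max_eq_left (by linarith)
    have h2 := h.le x
    simp only [icdf] at *
    rw [hF (continuous_hockey x), hG _ (continuous_hockey x)]
    linarith
  refine ⟨?_, ?_, fun x => ?_⟩
  · rw [measureReal_restrict_apply_univ, measureReal_restrict_apply_univ,
      measureReal_compl measurableSet_Ioc, measureReal_compl (measurableSet_singleton m), h.mass,
      hmass]
  · rw [hF continuous_subtype_val, hG _ continuous_subtype_val, h.mean, hmean]; ring
  · by_cases hx : x ≤ a ∨ (b : ℝ) ≤ x
    · exact key x hx
    -- replace the function by its chord over the interval, which gives a mixture of the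
    -- functions `(a - ω)⁺` and `(b - ω)⁺`
    push Not at hx
    obtain ⟨hax, hxb⟩ := hx
    have hab : 0 < (b : ℝ) - a := by linarith
    set β := (x - a) / ((b : ℝ) - a) with hβ
    have hβ0 : 0 ≤ β := div_nonneg (by linarith) hab.le
    have hβ1 : 0 ≤ 1 - β := by
      rw [hβ, sub_nonneg, div_le_one hab]; linarith
    have hxβ : x = (1 - β) * a + β * b := by
      have : β * ((b : ℝ) - a) = x - a := div_mul_cancel₀ _ hab.ne'
      linarith
    have hsplit : ∀ (H : Measure I) [IsFiniteMeasure H],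
        ∫ ω, ((1 - β) * max ((a : ℝ) - ω) 0 + β * max ((b : ℝ) - ω) 0) ∂H =
          (1 - β) * icdf H a + β * icdf H b := fun H _ => by
      rw [integral_add ((integrable_hockey H a).const_mul _) ((integrable_hockey H b).const_mul _),
        integral_const_mul, integral_const_mul, icdf, icdf]
    calc icdf (G.restrict {m}ᶜ) x
        ≤ ∫ ω in {m}ᶜ, ((1 - β) * max ((a : ℝ) - ω) 0 + β * max ((b : ℝ) - ω) 0) ∂G := by
          refine integral_mono (integrable_hockey _ _) (integrable_of_continuous _ (by fun_prop))
            fun ω => ?_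
          have h1 := mul_le_mul_of_nonneg_left (le_max_left ((a : ℝ) - ω) 0) hβ1
          have h2 := mul_le_mul_of_nonneg_left (le_max_left ((b : ℝ) - ω) 0) hβ0
          have h3 := mul_nonneg hβ1 (le_max_right ((a : ℝ) - ω) 0)
          have h4 := mul_nonneg hβ0 (le_max_right ((b : ℝ) - ω) 0)
          refine max_le ?_ (by positivity)
          linarith
      _ = (1 - β) * icdf (G.restrict {m}ᶜ) a + β * icdf (G.restrict {m}ᶜ) b := hsplit _
      _ ≤ (1 - β) * icdf (F.restrict (Set.Ioc a b)ᶜ) a + β * icdf (F.restrict (Set.Ioc a b)ᶜ) b :=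
          add_le_add (mul_le_mul_of_nonneg_left (key a (Or.inl le_rfl)) hβ1)
            (mul_le_mul_of_nonneg_left (key b (Or.inr le_rfl)) hβ0)
      _ = ∫ ω in (Set.Ioc a b)ᶜ,
            ((1 - β) * max ((a : ℝ) - ω) 0 + β * max ((b : ℝ) - ω) 0) ∂F := (hsplit _).symm
      _ = icdf (F.restrict (Set.Ioc a b)ᶜ) x := by
          refine setIntegral_congr_fun measurableSet_Ioc.compl fun ω hω => ?_
          have hω' : (ω : ℝ) ≤ a ∨ (b : ℝ) < ω := by
            by_contra! hcon
            exact hω ⟨hcon.1, hcon.2⟩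
          rcases hω' with h1 | h1
          · rw [max_eq_left (by linarith), max_eq_left (by linarith), max_eq_left (by linarith)]
            linarith
          · rw [max_eq_right (by linarith), max_eq_right (by linarith), max_eq_right (by linarith)]
            ring

/-- A finitely supported mean-preserving contraction `G` of an atomless `F` arises by pooling
states in pairwise separated cells, one for each atom. The atoms are treated in turn: each one
takes an interval, minus what earlier atoms have taken, and the last one takes the rest. -/
theorem ConvexOrder.exists_laminar_map {s : Finset I} (hs : s.Nonempty) {G F : Measure I}
    [IsFiniteMeasure G] [IsFiniteMeasure F] [NullSingletonClass F] (h : ConvexOrder G F)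
    (hG : G (s : Set I)ᶜ = 0) :
    ∃ T : I → I, Measurable T ∧ (∀ ω, T ω ∈ s) ∧
      (∀ m ∈ s, F.real (T ⁻¹' {m}) = G.real {m} ∧
        ∫ ω in T ⁻¹' {m}, (ω : ℝ) ∂F = m * G.real {m}) ∧
      Pairwise fun m m' => Separated (T ⁻¹' {m}) (T ⁻¹' {m'}) := by
  classical
  induction hs using Finset.Nonempty.cons_induction generalizing G F with
  | singleton m =>
    have hG' : G {m}ᶜ = 0 := by simpa using hG
    have hmass : G.real {m} = G.real Set.univ := by
      rw [← add_zero (G.real {m}), ← measureReal_add_measureReal_compl (measurableSet_singleton m)]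
      simp [measureReal_def, hG']
    refine ⟨fun _ => m, measurable_const, by simp, ?_, ?_⟩
    · intro m' hm'
      obtain rfl : m' = m := by simpa using hm'
      have hmean := integral_restrict_compl_singleton G m' continuous_subtype_val
      rw [setIntegral_measure_zero _ hG'] at hmean
      have : (fun _ : I => m') ⁻¹' {m'} = Set.univ := by ext; simp
      rw [this, setIntegral_univ, ← h.mean, ← h.mass, hmass]
      refine ⟨rfl, ?_⟩
      rw [← hmass]; linarith
    · intro m₁ m₂ hne
      have : ∀ m' : I, m' ≠ m → (fun _ : I => m) ⁻¹' {m'} = ∅ := fun m' hm' => by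
        ext; simp [hm'.symm]
      by_cases h1 : m₁ = m
      · rw [this m₂ (fun h2 => hne (h1.trans h2.symm))]
        exact ⟨Set.univ, Set.ordConnected_univ, Or.inl ⟨Set.subset_univ _, by simp⟩⟩
      · rw [this m₁ h1]
        exact ⟨Set.univ, Set.ordConnected_univ, Or.inr ⟨Set.subset_univ _, by simp⟩⟩
  | cons m s hm hs ih =>
    obtain ⟨a, b, hab, hmass, hmean⟩ := h.exists_Ioc m
    have hcompl : (G.restrict {m}ᶜ) (s : Set I)ᶜ = 0 := by
      rw [Measure.restrict_apply s.measurableSet.compl]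
      convert hG using 2
      ext; simp [and_comm]
    obtain ⟨T, hT, hTs, hTm, hTsep⟩ := ih (h.restrict_compl hmass hmean) hcompl
    set K := Set.Ioc a b with hK
    have hKm : MeasurableSet K := measurableSet_Ioc
    have hpre : ∀ m' ≠ m, (K.piecewise (fun _ => m) T) ⁻¹' {m'} = T ⁻¹' {m'} ∩ Kᶜ := by
      intro m' hm'
      ext ω
      by_cases hω : ω ∈ K <;> simp [hω, hm'.symm]
    have hpre' : (K.piecewise (fun _ => m) T) ⁻¹' {m} = K := by
      ext ω
      by_cases hω : ω ∈ K
      · simp [hω]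
      · have : T ω ≠ m := fun heq => hm (heq ▸ hTs ω)
        simp [hω, this]
    refine ⟨K.piecewise (fun _ => m) T, measurable_const.piecewise hKm hT, ?_, ?_, ?_⟩
    · intro ω
      by_cases hω : ω ∈ K <;> simp [hω, hTs ω]
    · intro m' hm'
      rcases Finset.mem_cons.1 hm' with rfl | hm's
      · rw [hpre']; exact ⟨hmass, hmean⟩
      · have hne : m' ≠ m := fun heq => hm (heq ▸ hm's)
        have := hTm m' hm's
        have hTm' : MeasurableSet (T ⁻¹' {m'}) := hT (measurableSet_singleton m')
        rw [hpre m' hne]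
        rw [measureReal_restrict_apply hTm', Measure.restrict_restrict hTm',
          measureReal_restrict_apply (measurableSet_singleton m')] at this
        rwa [Set.inter_eq_left.2 (Set.singleton_subset_iff.2 hne :
          ({m'} : Set I) ⊆ {m}ᶜ)] at this
    · have hsep : ∀ m' ≠ m, Separated ((K.piecewise (fun _ => m) T) ⁻¹' {m})
          ((K.piecewise (fun _ => m) T) ⁻¹' {m'}) := fun m' hm' => by
        rw [hpre', hpre m' hm']
        exact ⟨K, Set.ordConnected_Ioc, Or.inl ⟨le_rfl,
          Set.disjoint_left.2 fun x hx hx' => hx.2 hx'⟩⟩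
      intro m₁ m₂ hne
      by_cases h1 : m₁ = m
      · subst h1; exact hsep m₂ hne.symm
      by_cases h2 : m₂ = m
      · subst h2; exact (hsep m₁ hne).symm
      rw [hpre m₁ h1, hpre m₂ h2]
      exact (hTsep hne).mono Set.inter_subset_left Set.inter_subset_left

/-! ### Gaps of a closed set and maps defined gap by gap -/

/-- `(a, b)` is a connected component of the complement of `C`. -/
structure IsGap (C : Set I) (a b : I) : Prop where
  left_mem : a ∈ C
  right_mem : b ∈ C
  lt : a < b
  disjoint : Disjoint (Set.Ioo a b) C

lemma IsGap.notMem {C : Set I} {a b ω : I} (h : IsGap C a b) (hω : ω ∈ Set.Ioo a b) : ω ∉ C :=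
  Set.disjoint_left.1 h.disjoint hω

lemma IsGap.unique {C : Set I} {a b a' b' ω : I} (h : IsGap C a b) (h' : IsGap C a' b')
    (hω : ω ∈ Set.Ioo a b) (hω' : ω ∈ Set.Ioo a' b') : a = a' ∧ b = b' := by
  constructor
  · apply le_antisymm
    · by_contra! hlt
      exact h'.notMem ⟨hlt, hω.1.trans hω'.2⟩ h.left_mem
    · by_contra! hlt
      exact h.notMem ⟨hlt, hω'.1.trans hω.2⟩ h'.left_mem
  · apply le_antisymm
    · by_contra! hlt
      exact h.notMem ⟨hω.1.trans hω'.2, hlt⟩ h'.right_mem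
    · by_contra! hlt
      exact h'.notMem ⟨hω'.1.trans hω.2, hlt⟩ h.right_mem

lemma exists_isGap {C : Set I} (hC : IsClosed C) (h0 : 0 ∈ C) (h1 : 1 ∈ C) {ω : I} (hω : ω ∉ C) :
    ∃ a b, IsGap C a b ∧ ω ∈ Set.Ioo a b := by
  obtain ⟨a, ⟨haC, haω⟩, ha⟩ := (hC.inter isClosed_Iic).isCompact.exists_isGreatest
    (⟨0, h0, unitInterval.nonneg'⟩ : (C ∩ Set.Iic ω).Nonempty)
  obtain ⟨b, ⟨hbC, hbω⟩, hb⟩ := (hC.inter isClosed_Ici).isCompact.exists_isLeast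
    (⟨1, h1, unitInterval.le_one'⟩ : (C ∩ Set.Ici ω).Nonempty)
  have haω' : a < ω := lt_of_le_of_ne haω fun h => hω (h ▸ haC)
  have hbω' : ω < b := lt_of_le_of_ne hbω fun h => hω (h ▸ hbC)
  refine ⟨a, b, ⟨haC, hbC, haω'.trans hbω', Set.disjoint_left.2 fun x hx hxC => ?_⟩, haω', hbω'⟩
  rcases le_total x ω with h | h
  · exact not_lt.2 (ha ⟨hxC, h⟩) hx.1
  · exact not_lt.2 (hb ⟨hxC, h⟩) hx.2

/-- The map `T` fixes `C` and agrees with `t a b` on every gap `(a, b)` of `C`. -/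
structure IsGluing (C : Set I) (t : I → I → I → I) (T : I → I) : Prop where
  eq_self : ∀ ω ∈ C, T ω = ω
  eq_of_gap : ∀ a b, IsGap C a b → ∀ ω ∈ Set.Ioo a b, T ω = t a b ω

section Gluing

variable {C : Set I} {t : I → I → I → I} {T : I → I}

lemma exists_isGluing (hC : IsClosed C) (h0 : 0 ∈ C) (h1 : 1 ∈ C) (t : I → I → I → I) :
    ∃ T, IsGluing C t T := by
  classical
  have : ∀ ω, ∃ y, (ω ∈ C → y = ω) ∧ ∀ a b, IsGap C a b → ω ∈ Set.Ioo a b → y = t a b ω := by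
    intro ω
    by_cases hω : ω ∈ C
    · exact ⟨ω, fun _ => rfl, fun a b h hab => absurd hω (h.notMem hab)⟩
    · obtain ⟨a, b, h, hab⟩ := exists_isGap hC h0 h1 hω
      refine ⟨t a b ω, fun hω' => absurd hω' hω, fun a' b' h' hab' => ?_⟩
      obtain ⟨rfl, rfl⟩ := h.unique h' hab hab'
      rfl
  choose T hT using this
  exact ⟨T, fun ω => (hT ω).1, fun a b h ω hω => (hT ω).2 a b h hω⟩

variable (hT : IsGluing C t T) (hC : IsClosed C) (h0 : 0 ∈ C) (h1 : 1 ∈ C)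
  (ht : ∀ a b, IsGap C a b → ∀ ω, t a b ω ∈ Set.Ioo a b)
include hT hC h0 h1 ht

lemma IsGluing.mem_Ioo_iff {a b ω : I} (h : IsGap C a b) : T ω ∈ Set.Ioo a b ↔ ω ∈ Set.Ioo a b := by
  refine ⟨fun hω => ?_, fun hω => by rw [hT.eq_of_gap a b h ω hω]; exact ht a b h ω⟩
  by_cases hωC : ω ∈ C
  · rwa [hT.eq_self ω hωC] at hω
  · obtain ⟨a', b', h', hab'⟩ := exists_isGap hC h0 h1 hωC
    rw [hT.eq_of_gap a' b' h' ω hab'] at hω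
    obtain ⟨rfl, rfl⟩ := h.unique h' hω (ht a' b' h' ω)
    exact hab'

lemma IsGluing.eq_iff {c ω : I} (hc : c ∈ C) : T ω = c ↔ ω = c := by
  refine ⟨fun h => ?_, fun h => by rw [h, hT.eq_self c hc]⟩
  by_cases hωC : ω ∈ C
  · rw [← h, hT.eq_self ω hωC]
  · obtain ⟨a', b', h', hab'⟩ := exists_isGap hC h0 h1 hωC
    have := h'.notMem ((hT.mem_Ioo_iff hC h0 h1 ht h').2 hab')
    exact absurd (h ▸ hc) this

lemma IsGluing.preimage_Iic {x : I} (hx : x ∈ C) : T ⁻¹' Set.Iic x = Set.Iic x := by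
  ext ω
  simp only [Set.mem_preimage, Set.mem_Iic]
  by_cases hωC : ω ∈ C
  · rw [hT.eq_self ω hωC]
  · obtain ⟨a, b, h, hab⟩ := exists_isGap hC h0 h1 hωC
    have hTω := (hT.mem_Ioo_iff hC h0 h1 ht h).2 hab
    have key : ∀ y ∈ Set.Ioo a b, (y ≤ x ↔ b ≤ x) := fun y hy => by
      refine ⟨fun hyx => ?_, fun hbx => hy.2.le.trans hbx⟩
      by_contra! hlt
      exact h.notMem ⟨hy.1.trans_le hyx, hlt⟩ hx
    rw [key _ hTω, key _ hab]

lemma IsGluing.preimage_Iic_of_gap {a b x : I} (h : IsGap C a b) (hx : x ∈ Set.Ioo a b) :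
    T ⁻¹' Set.Iic x = Set.Iic a ∪ (Set.Ioo a b ∩ t a b ⁻¹' Set.Iic x) := by
  ext ω
  have hpre := Set.ext_iff.1 (hT.preimage_Iic hC h0 h1 ht h.left_mem) ω
  have hpreb := Set.ext_iff.1 (hT.preimage_Iic hC h0 h1 ht h.right_mem) ω
  simp only [Set.mem_preimage, Set.mem_Iic, Set.mem_union, Set.mem_inter_iff] at hpre hpreb ⊢
  constructor
  · intro hω
    by_cases hωa : ω ≤ a
    · exact Or.inl hωa
    · have hmem : T ω ∈ Set.Ioo a b := ⟨not_le.1 fun h' => hωa (hpre.1 h'), hω.trans_lt hx.2⟩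
      have hmem' := (hT.mem_Ioo_iff hC h0 h1 ht h).1 hmem
      rw [hT.eq_of_gap a b h ω hmem'] at hω
      exact Or.inr ⟨hmem', hω⟩
  · rintro (hω | ⟨hω, hω'⟩)
    · exact (hpre.2 hω).trans hx.1.le
    · rwa [hT.eq_of_gap a b h ω hω]

lemma IsGluing.measurable (htm : ∀ a b, IsGap C a b → Measurable (t a b)) : Measurable T := by
  refine measurable_of_Iic fun x => ?_
  by_cases hx : x ∈ C
  · rw [hT.preimage_Iic hC h0 h1 ht hx]; exact measurableSet_Iic
  · obtain ⟨a, b, h, hab⟩ := exists_isGap hC h0 h1 hx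
    rw [hT.preimage_Iic_of_gap hC h0 h1 ht h hab]
    exact measurableSet_Iic.union (measurableSet_Ioo.inter (htm a b h measurableSet_Iic))

/-- A gluing transports `ν` to `ν'` if it does so on every gap and if the two measures have equal
distribution functions on `C`. The comparison of distribution functions avoids a sum over gaps. -/
lemma IsGluing.map_eq (htm : ∀ a b, IsGap C a b → Measurable (t a b)) {ν ν' : Measure I}
    [IsFiniteMeasure ν] (hνC : ∀ x ∈ C, ν (Set.Iic x) = ν' (Set.Iic x))
    (hνt : ∀ a b, IsGap C a b →
      (ν.restrict (Set.Ioo a b)).map (t a b) = ν'.restrict (Set.Ioo a b)) :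
    ν.map T = ν' := by
  have hTm := hT.measurable hC h0 h1 ht htm
  refine Measure.ext_of_Iic _ _ fun x => ?_
  rw [Measure.map_apply hTm measurableSet_Iic]
  by_cases hx : x ∈ C
  · rw [hT.preimage_Iic hC h0 h1 ht hx, hνC x hx]
  · obtain ⟨a, b, h, hab⟩ := exists_isGap hC h0 h1 hx
    have hdisj : ∀ S : Set I, Disjoint (Set.Iic a) (Set.Ioo a b ∩ S) := fun S =>
      Set.disjoint_left.2 fun y hy hy' => not_lt.2 hy hy'.1.1
    have h2 := congrArg (fun m => m (Set.Iic x)) (hνt a b h)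
    rw [Measure.map_apply (htm a b h) measurableSet_Iic,
      Measure.restrict_apply (htm a b h measurableSet_Iic),
      Measure.restrict_apply measurableSet_Iic, Set.inter_comm, Set.inter_comm (Set.Iic x)] at h2
    have h3 : Set.Iic x = Set.Iic a ∪ (Set.Ioo a b ∩ Set.Iic x) := by
      ext y
      simp only [Set.mem_Iic, Set.mem_union, Set.mem_inter_iff, Set.mem_Ioo]
      constructor
      · intro hy
        by_cases hya : y ≤ a
        · exact Or.inl hya
        · exact Or.inr ⟨⟨not_le.1 hya, hy.trans_lt hab.2⟩, hy⟩
      · rintro (hy | hy)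
        · exact hy.trans hab.1.le
        · exact hy.2
    rw [hT.preimage_Iic_of_gap hC h0 h1 ht h hab, measure_union (hdisj _)
      (measurableSet_Ioo.inter (htm a b h measurableSet_Iic)), h2, hνC a h.left_mem,
      ← measure_union (hdisj _) (measurableSet_Ioo.inter measurableSet_Iic), ← h3]

lemma IsGluing.pairwise_separated (hsep : ∀ a b, IsGap C a b →
      Pairwise fun m m' => Separated (t a b ⁻¹' {m}) (t a b ⁻¹' {m'})) :
    Pairwise fun m m' => Separated (T ⁻¹' {m}) (T ⁻¹' {m'}) := by
  -- a fibre over a point of `C` is a singleton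
  have hC' : ∀ m ∈ C, ∀ m', m ≠ m' → Separated (T ⁻¹' {m}) (T ⁻¹' {m'}) := fun m hm m' hne => by
    have : T ⁻¹' {m} = {m} := by ext ω; exact hT.eq_iff hC h0 h1 ht hm
    rw [this]
    refine ⟨{m}, Set.ordConnected_singleton, Or.inl ⟨le_rfl, ?_⟩⟩
    rw [Set.disjoint_singleton_right]
    intro hm'
    exact hne ((hT.eq_self m hm).symm.trans hm')
  intro m m' hne
  by_cases hm : m ∈ C
  · exact hC' m hm m' hne
  by_cases hm' : m' ∈ C
  · exact (hC' m' hm' m hne.symm).symm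
  obtain ⟨a, b, h, hab⟩ := exists_isGap hC h0 h1 hm
  have hfib : ∀ y ∈ Set.Ioo a b, T ⁻¹' {y} ⊆ Set.Ioo a b := fun y hy ω hω =>
    (hT.mem_Ioo_iff hC h0 h1 ht h).1 (by rw [show T ω = y from hω]; exact hy)
  by_cases hab' : m' ∈ Set.Ioo a b
  · refine (hsep a b h hne).mono ?_ ?_
    · intro ω hω
      rw [Set.mem_preimage, ← hT.eq_of_gap a b h ω (hfib m hab hω)]; exact hω
    · intro ω hω
      rw [Set.mem_preimage, ← hT.eq_of_gap a b h ω (hfib m' hab' hω)]; exact hω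
  · refine ⟨Set.Ioo a b, Set.ordConnected_Ioo, Or.inl ⟨hfib m hab, ?_⟩⟩
    refine Set.disjoint_left.2 fun ω hω hω' => hab' ?_
    rw [← show T ω = m' from hω]
    exact (hT.mem_Ioo_iff hC h0 h1 ht h).2 hω'

end Gluing

/-! ### The contact set of a mean-preserving contraction -/

/-- The set where the integrated distribution functions of `G` and of its mean-preserving spread `F`
touch. -/
def contactSet (G F : Measure I) : Set I := {x | icdf F x ≤ icdf G x}

lemma continuous_icdf (G : Measure I) [IsFiniteMeasure G] : Continuous fun x : I => icdf G x := by
  refine continuous_of_dominated (bound := fun _ => 1) ?_ ?_ (integrable_const _) ?_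
  · exact fun x => (continuous_hockey x).aestronglyMeasurable
  · refine fun x => .of_forall fun ω => ?_
    rw [Real.norm_eq_abs, abs_of_nonneg (le_max_right _ _)]
    exact max_le (by linarith [x.2.2, ω.2.1]) zero_le_one
  · exact .of_forall fun ω => by fun_prop

lemma isClosed_contactSet (G F : Measure I) [IsFiniteMeasure G] [IsFiniteMeasure F] :
    IsClosed (contactSet G F) :=
  isClosed_le (continuous_icdf F) (continuous_icdf G)

lemma zero_mem_contactSet (G F : Measure I) : (0 : I) ∈ contactSet G F := by
  have : ∀ H : Measure I, icdf H ((0 : I) : ℝ) = 0 := fun H => by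
    have : ∀ ω : I, max (((0 : I) : ℝ) - ω) 0 = 0 := fun ω =>
      max_eq_right (by simpa using ω.2.1)
    simp only [icdf, this, integral_zero]
  exact (this F).trans_le (this G).ge

lemma icdf_one (G : Measure I) [IsFiniteMeasure G] :
    icdf G ((1 : I) : ℝ) = G.real Set.univ - ∫ ω, (ω : ℝ) ∂G := by
  have : Set.Iic (1 : I) = Set.univ := by ext x; simp [unitInterval.le_one']
  rw [icdf_eq, this]; simp

lemma ConvexOrder.icdf_eq_of_mem {G F : Measure I} (h : ConvexOrder G F) {x : I}
    (hx : x ∈ contactSet G F) :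
    icdf G x = icdf F x := le_antisymm (h.le x) hx

section

variable {G F : Measure I} [IsFiniteMeasure G] [IsFiniteMeasure F]

lemma ConvexOrder.one_mem_contactSet (h : ConvexOrder G F) : (1 : I) ∈ contactSet G F := by
  change icdf F _ ≤ icdf G _
  rw [icdf_one, icdf_one, h.mass, h.mean]

lemma icdf_sub_le (G : Measure I) [IsFiniteMeasure G] {x y : I} (hxy : x ≤ y) :
    icdf G y - icdf G x ≤ (y - x) * G.real (Set.Iio y) := by
  have : ((y : ℝ) - x) * G.real (Set.Iio y) =
      ∫ ω, (Set.Iio y).indicator (fun _ => (y : ℝ) - x) ω ∂G := by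
    rw [integral_indicator measurableSet_Iio]; simp [mul_comm]
  rw [this, icdf, icdf, ← integral_sub (integrable_hockey _ _) (integrable_hockey _ _)]
  refine integral_mono ((integrable_hockey _ _).sub (integrable_hockey _ _))
    ((integrable_const _).indicator measurableSet_Iio) fun ω => ?_
  have hxy' : (x : ℝ) ≤ y := hxy
  by_cases hω : ω < y
  · have : (ω : ℝ) < y := hω
    simp only [Set.indicator, Set.mem_Iio, hω, if_true]
    rw [max_eq_left (by linarith)]
    linarith [le_max_left ((x : ℝ) - ω) 0]
  · have : (y : ℝ) ≤ ω := not_lt.1 hω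
    simp only [Set.indicator, Set.mem_Iio, hω, if_false]
    rw [max_eq_right (by linarith), max_eq_right (by linarith), sub_zero]

lemma le_icdf_sub (G : Measure I) [IsFiniteMeasure G] {x y : I} (hxy : x ≤ y) :
    (y - x) * G.real (Set.Iic x) ≤ icdf G y - icdf G x := by
  have : ((y : ℝ) - x) * G.real (Set.Iic x) =
      ∫ ω, (Set.Iic x).indicator (fun _ => (y : ℝ) - x) ω ∂G := by
    rw [integral_indicator measurableSet_Iic]; simp [mul_comm]
  rw [this, icdf, icdf, ← integral_sub (integrable_hockey _ _) (integrable_hockey _ _)]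
  refine integral_mono ((integrable_const _).indicator measurableSet_Iic)
    ((integrable_hockey _ _).sub (integrable_hockey _ _)) fun ω => ?_
  have hxy' : (x : ℝ) ≤ y := hxy
  by_cases hω : ω ≤ x
  · have : (ω : ℝ) ≤ x := hω
    simp only [Set.indicator, Set.mem_Iic, hω, if_true]
    rw [max_eq_left (by linarith), max_eq_left (by linarith)]
    linarith
  · have : (x : ℝ) < ω := not_le.1 hω
    simp only [Set.indicator, Set.mem_Iic, hω, if_false]
    rw [max_eq_right (a := (x : ℝ) - ω) (by linarith), sub_zero]
    exact le_max_right _ _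

variable [NullSingletonClass F]

/-- Together with `ConvexOrder.le_real_Iio`: where the smaller of two convex functions touches the
larger one and the latter is differentiable, their derivatives agree. -/
lemma ConvexOrder.real_Iic_le (h : ConvexOrder G F) {x : I} (hx : x ∈ contactSet G F) :
    G.real (Set.Iic x) ≤ F.real (Set.Iic x) := by
  by_cases hx1 : x = 1
  · have : Set.Iic x = Set.univ := by ext y; simp [hx1, unitInterval.le_one']
    rw [this, h.mass]
  have hlt : x < 1 := lt_of_le_of_ne unitInterval.le_one' hx1
  have : (nhdsWithin (x : I) (Set.Ioi x)).NeBot := nhdsGT_neBot_of_exists_gt (α := I) ⟨1, hlt⟩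
  refine ge_of_tendsto (((continuous_real_Iic F).tendsto x).mono_left
    (nhdsWithin_le_nhds (s := Set.Ioi x))) ?_
  filter_upwards [self_mem_nhdsWithin] with y hy
  have hy' : (x : ℝ) < y := hy
  have h1 := le_icdf_sub G (le_of_lt hy)
  have h2 := icdf_sub_le F (le_of_lt hy)
  have h3 := h.le y
  have h4 := h.icdf_eq_of_mem hx
  have h5 : F.real (Set.Iio y) ≤ F.real (Set.Iic y) := measureReal_mono Set.Iio_subset_Iic_self
  have h6 : ((y : ℝ) - x) * G.real (Set.Iic x) ≤ (y - x) * F.real (Set.Iio y) := by linarith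
  exact (le_of_mul_le_mul_left h6 (by linarith)).trans h5

lemma ConvexOrder.le_real_Iio (h : ConvexOrder G F) {x : I} (hx : x ∈ contactSet G F) :
    F.real (Set.Iic x) ≤ G.real (Set.Iio x) := by
  by_cases hx0 : x = 0
  · have : Set.Iic x = {0} := by ext y; simp [hx0]
    rw [this]; simp [measureReal_def]
  have hlt : 0 < x := lt_of_le_of_ne unitInterval.nonneg' (Ne.symm hx0)
  have : (nhdsWithin (x : I) (Set.Iio x)).NeBot := nhdsLT_neBot_of_exists_lt (α := I) ⟨0, hlt⟩
  refine le_of_tendsto (((continuous_real_Iic F).tendsto x).mono_left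
    (nhdsWithin_le_nhds (s := Set.Iio x))) ?_
  filter_upwards [self_mem_nhdsWithin] with y hy
  have hy' : (y : ℝ) < x := hy
  have h1 := le_icdf_sub F (le_of_lt hy)
  have h2 := icdf_sub_le G (le_of_lt hy)
  have h3 := h.le y
  have h4 := h.icdf_eq_of_mem hx
  have h6 : ((x : ℝ) - y) * F.real (Set.Iic y) ≤ (x - y) * G.real (Set.Iio x) := by linarith
  exact le_of_mul_le_mul_left h6 (by linarith)

lemma ConvexOrder.real_Iic_eq (h : ConvexOrder G F) {x : I} (hx : x ∈ contactSet G F) :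
    G.real (Set.Iic x) = F.real (Set.Iic x) :=
  le_antisymm (h.real_Iic_le hx)
    ((h.le_real_Iio hx).trans (measureReal_mono Set.Iio_subset_Iic_self))

lemma ConvexOrder.measure_singleton (h : ConvexOrder G F) {x : I} (hx : x ∈ contactSet G F) :
    G {x} = 0 := by
  have h1 := h.real_Iic_le hx
  have h2 := h.le_real_Iio hx
  have h3 : G.real (Set.Iic x) = G.real (Set.Iio x) + G.real {x} := by
    rw [← measureReal_union (by simp) (measurableSet_singleton x), Set.Iio_union_right]
  have h4 : G.real {x} = 0 := le_antisymm (by linarith) measureReal_nonneg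
  simpa [measureReal_def, ENNReal.toReal_eq_zero_iff] using h4

lemma ConvexOrder.setIntegral_Iic_eq (h : ConvexOrder G F) {x : I} (hx : x ∈ contactSet G F) :
    ∫ ω in Set.Iic x, (ω : ℝ) ∂G = ∫ ω in Set.Iic x, (ω : ℝ) ∂F := by
  have h1 := h.icdf_eq_of_mem hx
  rw [icdf_eq, icdf_eq, h.real_Iic_eq hx] at h1
  linarith

lemma setIntegral_Iic_hockey (G : Measure I) [IsFiniteMeasure G] {a : I} {x : ℝ} (h : (a : ℝ) ≤ x) :
    ∫ ω in Set.Iic a, max (x - (ω : ℝ)) 0 ∂G =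
      x * G.real (Set.Iic a) - ∫ ω in Set.Iic a, (ω : ℝ) ∂G := by
  rw [setIntegral_congr_fun (g := fun ω : I => x - (ω : ℝ)) measurableSet_Iic,
    integral_const_sub, measureReal_restrict_apply_univ]
  intro ω hω
  have : (ω : ℝ) ≤ a := hω
  exact max_eq_left (by linarith)

/-- Between two points of contact, the contraction is one of the restricted measures. -/
lemma ConvexOrder.restrict_Ioc (h : ConvexOrder G F) {a b : I} (hab : a ≤ b)
    (ha : a ∈ contactSet G F) (hb : b ∈ contactSet G F) :
    ConvexOrder (G.restrict (Set.Ioc a b)) (F.restrict (Set.Ioc a b)) := by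
  refine ⟨?_, ?_, fun x => ?_⟩
  · rw [measureReal_restrict_apply_univ, measureReal_restrict_apply_univ, real_Ioc G hab,
      real_Ioc F hab, h.real_Iic_eq ha, h.real_Iic_eq hb]
  · rw [setIntegral_Ioc G (integrable_coe G) hab, setIntegral_Ioc F (integrable_coe F) hab,
      h.setIntegral_Iic_eq ha, h.setIntegral_Iic_eq hb]
  rw [icdf, icdf, setIntegral_Ioc G (integrable_hockey G x) hab,
    setIntegral_Ioc F (integrable_hockey F x) hab]
  have hC : ∀ c ∈ contactSet G F, (c : ℝ) ≤ x → ∫ ω in Set.Iic c, max (x - (ω : ℝ)) 0 ∂G =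
      ∫ ω in Set.Iic c, max (x - (ω : ℝ)) 0 ∂F := fun c hc hcx => by
    rw [setIntegral_Iic_hockey G hcx, setIntegral_Iic_hockey F hcx, h.real_Iic_eq hc,
      h.setIntegral_Iic_eq hc]
  have hzero : ∀ (H : Measure I) [IsFiniteMeasure H] (c : I), x ≤ c →
      ∫ ω in Set.Iic c, max (x - (ω : ℝ)) 0 ∂H = icdf H x := fun H _ c hc => by
    rw [icdf, ← integral_add_compl (s := Set.Iic c) measurableSet_Iic (integrable_hockey H x),
      setIntegral_congr_fun (g := fun _ => (0 : ℝ)) (s := (Set.Iic c)ᶜ) measurableSet_Iic.compl]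
    · simp
    · intro ω hω
      have : (c : ℝ) < ω := not_le.1 hω
      exact max_eq_right (by linarith)
  rcases le_total (b : ℝ) x with hbx | hbx
  · rw [hC b hb hbx, hC a ha (le_trans hab hbx)]
  · rw [hzero G b hbx, hzero F b hbx]
    rcases le_total (a : ℝ) x with hax | hax
    · rw [hC a ha hax]; linarith [h.le x]
    · rw [hzero G a hax, hzero F a hax]; simp

end

/-! ### Pooling maps that induce a given law of posterior means -/

/-- The measure `ω dG(ω)`. A map `T` with `F.map T = G` sends it to `firstMoment G` exactly if the
conditional mean of the state given `T` is `T`. -/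
def firstMoment (G : Measure I) : Measure I := G.withDensity fun ω => ENNReal.ofReal ω

lemma firstMoment_apply (G : Measure I) [IsFiniteMeasure G] {S : Set I} (hS : MeasurableSet S) :
    firstMoment G S = ENNReal.ofReal (∫ ω in S, (ω : ℝ) ∂G) := by
  rw [firstMoment, withDensity_apply _ hS, ofReal_integral_eq_lintegral_ofReal
    (integrable_coe _) (.of_forall fun ω => ω.2.1)]

instance (G : Measure I) [IsFiniteMeasure G] : IsFiniteMeasure (firstMoment G) :=
  ⟨by rw [firstMoment_apply G MeasurableSet.univ]; exact ENNReal.ofReal_lt_top⟩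

lemma firstMoment_restrict (G : Measure I) {S : Set I} (hS : MeasurableSet S) :
    firstMoment (G.restrict S) = (firstMoment G).restrict S :=
  (restrict_withDensity hS _).symm

lemma measure_eq_sum_singleton (ν : Measure I) (s : Finset I)
    (h : ν (s : Set I)ᶜ = 0) (B : Set I) :
    ν B = ∑ m ∈ s, B.indicator (fun m => ν {m}) m := by
  classical
  have h1 : ν B = ν (s.filter (· ∈ B) : Finset I) := by
    apply le_antisymm
    · calc ν B ≤ ν ((s.filter (· ∈ B) : Finset I) ∪ (s : Set I)ᶜ) := by
            refine measure_mono fun x hx => ?_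
            by_cases hxs : x ∈ s
            · exact Or.inl (by simp [hxs, hx])
            · exact Or.inr hxs
        _ ≤ _ := (measure_union_le _ _).trans (by rw [h, add_zero])
    · exact measure_mono fun x hx => by simpa using (Finset.mem_filter.1 hx).2
  rw [h1, ← sum_measure_singleton, Finset.sum_filter]
  rfl

lemma measure_ext_of_finset {ν ν' : Measure I} (s : Finset I)
    (h : ν (s : Set I)ᶜ = 0) (h' : ν' (s : Set I)ᶜ = 0) (heq : ∀ m ∈ s, ν {m} = ν' {m}) :
    ν = ν' := by
  ext B hB
  rw [measure_eq_sum_singleton ν s h, measure_eq_sum_singleton ν' s h']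
  refine Finset.sum_congr rfl fun m hm => ?_
  by_cases hmB : m ∈ B <;> simp [hmB, heq m hm]

lemma ConvexOrder.exists_laminar_map_eq {s : Finset I} (hs : s.Nonempty) {G F : Measure I}
    [IsFiniteMeasure G] [IsFiniteMeasure F] [NullSingletonClass F] (h : ConvexOrder G F)
    (hG : G (s : Set I)ᶜ = 0) :
    ∃ T : I → I, Measurable T ∧ (∀ ω, T ω ∈ s) ∧ F.map T = G ∧
      (firstMoment F).map T = firstMoment G ∧
      Pairwise fun m m' => Separated (T ⁻¹' {m}) (T ⁻¹' {m'}) := by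
  obtain ⟨T, hT, hTs, hTm, hsep⟩ := h.exists_laminar_map hs hG
  have hempty : T ⁻¹' (s : Set I)ᶜ = ∅ := by ext ω; simp [hTs ω]
  refine ⟨T, hT, hTs, ?_, ?_, hsep⟩
  · refine measure_ext_of_finset s ?_ hG fun m hm => ?_
    · rw [Measure.map_apply hT s.measurableSet.compl, hempty, measure_empty]
    · rw [Measure.map_apply hT (measurableSet_singleton m)]
      exact (measureReal_eq_measureReal_iff).1 (hTm m hm).1
  · refine measure_ext_of_finset s ?_ ?_ fun m hm => ?_
    · rw [Measure.map_apply hT s.measurableSet.compl, hempty, measure_empty]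
    · rw [firstMoment_apply G s.measurableSet.compl, setIntegral_measure_zero _ hG,
        ENNReal.ofReal_zero]
    · rw [Measure.map_apply hT (measurableSet_singleton m),
        firstMoment_apply F (hT (measurableSet_singleton m)), (hTm m hm).2,
        firstMoment_apply G (measurableSet_singleton m)]
      simp [mul_comm, measureReal_def]

/-- A mean-preserving contraction `G` of the atomless `F` with at most `N` atoms on every gap of the
contact set, and no other mass there, is the law of the posterior mean of a laminar pooling map `T`
whose values are the posterior means themselves. The intervals `J k` are the gaps, enumerated,
possibly with repetitions, through a dense sequence of states. -/
theorem ConvexOrder.exists_partition_map {G F : Measure I} [IsFiniteMeasure G] [IsFiniteMeasure F]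
    [NullSingletonClass F] (h : ConvexOrder G F) {N : ℕ} (hN : 1 ≤ N)
    (hfin : ∀ a b, IsGap (contactSet G F) a b →
      ∃ s : Finset I, (s : Set I) ⊆ Set.Ioo a b ∧ s.card ≤ N ∧ G (Set.Ioo a b \ s) = 0) :
    ∃ T : I → I, Measurable T ∧ F.map T = G ∧ (firstMoment F).map T = firstMoment G ∧
      (Pairwise fun m m' => Separated (T ⁻¹' {m}) (T ⁻¹' {m'})) ∧
      ∃ J : ℕ → Set I, (∀ k, (J k).OrdConnected) ∧
        (∀ ω ∉ ⋃ k, J k, ∀ ω', T ω' = T ω ↔ ω' = ω) ∧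
        ∀ k, (∀ ω ∈ J k, ∀ ω', T ω' = T ω → ω' ∈ J k) ∧ (T '' J k).encard ≤ N := by
  classical
  set C := contactSet G F with hCdef
  have hC : IsClosed C := isClosed_contactSet G F
  have h0 : 0 ∈ C := zero_mem_contactSet G F
  have h1 : 1 ∈ C := h.one_mem_contactSet
  have hgap : ∀ a b, ∃ (τ : I → I) (s : Finset I), IsGap C a b →
      (s : Set I) ⊆ Set.Ioo a b ∧ s.card ≤ N ∧ Measurable τ ∧ (∀ ω, τ ω ∈ s) ∧
      (F.restrict (Set.Ioo a b)).map τ = G.restrict (Set.Ioo a b) ∧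
      ((firstMoment F).restrict (Set.Ioo a b)).map τ = (firstMoment G).restrict (Set.Ioo a b) ∧
      Pairwise fun m m' => Separated (τ ⁻¹' {m}) (τ ⁻¹' {m'}) := by
    intro a b
    by_cases hab : IsGap C a b
    swap
    · exact ⟨id, ∅, fun h => absurd h hab⟩
    -- a gap of measure zero still needs a message, which can be any of its points
    obtain ⟨s, hne, hs, hcard, hGs⟩ : ∃ s : Finset I, s.Nonempty ∧ (s : Set I) ⊆ Set.Ioo a b ∧
        s.card ≤ N ∧ G (Set.Ioo a b \ s) = 0 := by
      obtain ⟨s, hs, hcard, hGs⟩ := hfin a b hab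
      rcases s.eq_empty_or_nonempty with rfl | hne
      · obtain ⟨c, hc⟩ := exists_between hab.lt
        refine ⟨{c}, by simp, by simpa using hc, by simpa using hN, ?_⟩
        exact measure_mono_null (Set.sdiff_subset_sdiff_right (by simp)) hGs
      · exact ⟨s, hne, hs, hcard, hGs⟩
    have hGae : (Set.Ioo a b) =ᵐ[G] Set.Ioc a b := by
      refine Set.Ioo_union_right hab.lt ▸ (union_ae_eq_left_of_ae_eq_empty ?_).symm
      exact ae_eq_empty.2 (h.measure_singleton hab.right_mem)
    have hord := h.restrict_Ioc hab.lt.le hab.left_mem hab.right_mem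
    rw [← Measure.restrict_congr_set hGae, ← Measure.restrict_congr_set Ioo_ae_eq_Ioc] at hord
    have hGs' : (G.restrict (Set.Ioo a b)) (s : Set I)ᶜ = 0 := by
      rw [Measure.restrict_apply s.measurableSet.compl, Set.inter_comm, ← Set.sdiff_eq, hGs]
    obtain ⟨τ, hτ, hτs, hmap, hmom, hsep⟩ := hord.exists_laminar_map_eq hne hGs'
    rw [firstMoment_restrict _ measurableSet_Ioo, firstMoment_restrict _ measurableSet_Ioo] at hmom
    exact ⟨τ, s, fun _ => ⟨hs, hcard, hτ, hτs, hmap, hmom, hsep⟩⟩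
  choose t s hts using hgap
  obtain ⟨T, hT⟩ := exists_isGluing hC h0 h1 t
  have ht : ∀ a b, IsGap C a b → ∀ ω, t a b ω ∈ Set.Ioo a b := fun a b hab ω =>
    (hts a b hab).1 ((hts a b hab).2.2.2.1 ω)
  have htm : ∀ a b, IsGap C a b → Measurable (t a b) := fun a b hab => (hts a b hab).2.2.1
  refine ⟨T, hT.measurable hC h0 h1 ht htm, ?_, ?_, ?_, ?_⟩
  · refine hT.map_eq hC h0 h1 ht htm (fun x hx => ?_) fun a b hab => (hts a b hab).2.2.2.2.1
    exact (measureReal_eq_measureReal_iff).1 (h.real_Iic_eq hx).symm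
  · refine hT.map_eq hC h0 h1 ht htm (fun x hx => ?_) fun a b hab => (hts a b hab).2.2.2.2.2.1
    rw [firstMoment_apply F measurableSet_Iic, firstMoment_apply G measurableSet_Iic,
      h.setIntegral_Iic_eq hx]
  · exact hT.pairwise_separated hC h0 h1 ht fun a b hab => (hts a b hab).2.2.2.2.2.2
  -- every gap contains a point of a countable dense set
  have hJ : ∀ k : ℕ, ∃ K : Set I, K.OrdConnected ∧
      (TopologicalSpace.denseSeq I k ∉ C → ∃ a b, IsGap C a b ∧
        TopologicalSpace.denseSeq I k ∈ Set.Ioo a b ∧ K = Set.Ioo a b) ∧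
      (TopologicalSpace.denseSeq I k ∈ C → K = ∅) := by
    intro k
    by_cases hk : TopologicalSpace.denseSeq I k ∈ C
    · exact ⟨∅, Set.ordConnected_empty, fun h => absurd hk h, fun _ => rfl⟩
    · obtain ⟨a, b, hab, hmem⟩ := exists_isGap hC h0 h1 hk
      exact ⟨Set.Ioo a b, Set.ordConnected_Ioo, fun _ => ⟨a, b, hab, hmem, rfl⟩,
        fun h => absurd h hk⟩
  choose J hJo hJ1 hJ2 using hJ
  refine ⟨J, hJo, fun ω hω ω' => ?_, fun k => ?_⟩
  · have hωC : ω ∈ C := by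
      by_contra hωC
      obtain ⟨a, b, hab, hmem⟩ := exists_isGap hC h0 h1 hωC
      obtain ⟨k, hx⟩ := (TopologicalSpace.denseRange_denseSeq I).exists_mem_open
        isOpen_Ioo ⟨ω, hmem⟩
      obtain ⟨a', b', hab', hmem', hK⟩ := hJ1 k (hab.notMem hx)
      obtain ⟨rfl, rfl⟩ := hab.unique hab' hx hmem'
      exact hω (Set.mem_iUnion.2 ⟨k, hK ▸ hmem⟩)
    rw [hT.eq_self ω hωC]
    exact hT.eq_iff hC h0 h1 ht hωC
  · by_cases hk : TopologicalSpace.denseSeq I k ∈ C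
    · simp [hJ2 k hk]
    · obtain ⟨a, b, hab, -, hK⟩ := hJ1 k hk
      rw [hK]
      refine ⟨fun ω hω ω' heq => ?_, ?_⟩
      · rw [← hT.mem_Ioo_iff hC h0 h1 ht hab, heq, hT.mem_Ioo_iff hC h0 h1 ht hab]
        exact hω
      · calc (T '' Set.Ioo a b).encard ≤ ((s a b : Finset I) : Set I).encard := by
              refine Set.encard_le_encard ?_
              rintro _ ⟨ω, hω, rfl⟩
              rw [hT.eq_of_gap a b hab ω hω]
              exact (hts a b hab).2.2.2.1 ω
          _ ≤ N := by
              rw [Set.encard_coe_eq_coe_finsetCard]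
              exact_mod_cast (hts a b hab).2.1

/-! ### Perturbing a mean-preserving contraction -/

/-- The measure with density `1 + k` with respect to `G`; meaningful when `|k| ≤ 1`, as
`ENNReal.ofReal` truncates negative values. -/
def tilt (G : Measure I) (k : I → ℝ) : Measure I :=
  G.withDensity fun ω => ENNReal.ofReal (1 + k ω)

section

variable {G F : Measure I} {k : I → ℝ}

lemma integrable_mul_of_abs_le_one (hk : Measurable k) (hk1 : ∀ ω, |k ω| ≤ 1) {φ : I → ℝ}
    (hφ : Integrable φ G) : Integrable (fun ω => k ω * φ ω) G :=
  hφ.bdd_mul hk.aestronglyMeasurable (.of_forall fun ω => hk1 ω)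

lemma integral_tilt (hk : Measurable k) (hk1 : ∀ ω, |k ω| ≤ 1) {φ : I → ℝ}
    (hφ : Integrable φ G) : ∫ ω, φ ω ∂(tilt G k) = ∫ ω, φ ω ∂G + ∫ ω, k ω * φ ω ∂G := by
  rw [tilt, integral_withDensity_eq_integral_toReal_smul (by fun_prop) (by simp),
    ← integral_add hφ (integrable_mul_of_abs_le_one hk hk1 hφ)]
  congr 1; ext ω
  rw [ENNReal.toReal_ofReal (by linarith [(abs_le.1 (hk1 ω)).1]), smul_eq_mul]
  ring

variable [IsProbabilityMeasure G]

lemma isProbabilityMeasure_tilt (hk : Measurable k) (hk1 : ∀ ω, |k ω| ≤ 1)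
    (hk0 : ∫ ω, k ω ∂G = 0) : IsProbabilityMeasure (tilt G k) := by
  constructor
  rw [tilt, withDensity_apply _ MeasurableSet.univ, Measure.restrict_univ,
    ← ofReal_integral_eq_lintegral_ofReal]
  · have hki : Integrable k G := by
      simpa using integrable_mul_of_abs_le_one hk hk1 (integrable_const (1 : ℝ) (μ := G))
    rw [integral_add (integrable_const _) hki, hk0]
    simp
  · have hki : Integrable k G := by
      simpa using integrable_mul_of_abs_le_one hk hk1 (integrable_const (1 : ℝ) (μ := G))
    exact (integrable_const _).add hki
  · exact .of_forall fun ω => by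
      change 0 ≤ 1 + k ω
      linarith [(abs_le.1 (hk1 ω)).1]

/-- A tilt that preserves mass and mean and is confined to an interval on which the order
constraint is slack by `δ ≥ |k|` preserves the order. -/
lemma ConvexOrder.left_tilt [IsFiniteMeasure F] (h : ConvexOrder G F) (hk : Measurable k)
    (hk1 : ∀ ω, |k ω| ≤ 1) (hk0 : ∫ ω, k ω ∂G = 0) (hkm : ∫ ω, k ω * ω ∂G = 0) {a b : I}
    (hsupp : ∀ ω ∉ Set.Ioo a b, k ω = 0) {δ : ℝ} (hkδ : ∀ ω, |k ω| ≤ δ)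
    (hδ : ∀ x ∈ Set.Icc a b, icdf G x + δ ≤ icdf F x) : ConvexOrder (tilt G k) F := by
  have := isProbabilityMeasure_tilt hk hk1 hk0
  refine ⟨?_, ?_, fun x => ?_⟩
  · rw [← h.mass]; simp
  · rw [integral_tilt hk hk1 (integrable_coe G), hkm, h.mean, add_zero]
  rw [icdf, integral_tilt hk hk1 (integrable_hockey G x), ← icdf]
  by_cases hxa : x ≤ a
  · have : ∀ ω : I, k ω * max (x - (ω : ℝ)) 0 = 0 := fun ω => by
      by_cases hω : ω ∈ Set.Ioo a b
      · have : (a : ℝ) < ω := hω.1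
        rw [max_eq_right (by linarith), mul_zero]
      · rw [hsupp ω hω, zero_mul]
    simpa [this] using h.le x
  by_cases hxb : (b : ℝ) ≤ x
  · have h1 : ∀ ω : I, k ω * max (x - (ω : ℝ)) 0 = x * k ω - k ω * ω := fun ω => by
      by_cases hω : ω ∈ Set.Ioo a b
      · have : (ω : ℝ) < b := hω.2
        rw [max_eq_left (by linarith)]; ring
      · rw [hsupp ω hω]; ring
    have hki : Integrable k G := by
      simpa using integrable_mul_of_abs_le_one hk hk1 (integrable_const (1 : ℝ) (μ := G))
    simp only [h1]
    rw [integral_sub (hki.const_mul x) (integrable_mul_of_abs_le_one hk hk1 (integrable_coe G)),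
      integral_const_mul, hk0, hkm]
    simpa using h.le x
  · push Not at hxa hxb
    have hx1 : x ≤ 1 := hxb.le.trans b.2.2
    have hx := hδ ⟨x, a.2.1.trans hxa.le, hx1⟩ ⟨hxa.le, hxb.le⟩
    have h2 : ∫ ω, k ω * max (x - (ω : ℝ)) 0 ∂G ≤ ∫ ω, δ ∂G := by
      refine integral_mono (integrable_mul_of_abs_le_one hk hk1 (integrable_hockey G x))
        (integrable_const _) fun ω => ?_
      have h3 : max (x - (ω : ℝ)) 0 ≤ 1 := max_le (by linarith [ω.2.1]) zero_le_one
      calc k ω * max (x - (ω : ℝ)) 0 ≤ |k ω| * max (x - (ω : ℝ)) 0 :=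
            mul_le_mul_of_nonneg_right (le_abs_self _) (le_max_right _ _)
        _ ≤ |k ω| * 1 := mul_le_mul_of_nonneg_left h3 (abs_nonneg _)
        _ ≤ δ := by rw [mul_one]; exact hkδ ω
    rw [integral_const] at h2
    simp only [probReal_univ, one_smul] at h2
    simp only at hx
    linarith

end

lemma exists_ne_zero_sum_mul_eq_zero {ι κ : Type*} [Fintype ι] [Fintype κ]
    (h : Fintype.card κ < Fintype.card ι) (M : κ → ι → ℝ) :
    ∃ t : ι → ℝ, t ≠ 0 ∧ ∀ j, ∑ i, t i * M j i = 0 := by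
  have hker : (Matrix.mulVecLin (Matrix.of M)).ker ≠ ⊥ :=
    LinearMap.ker_ne_bot_of_finrank_lt (by simpa using h)
  obtain ⟨t, ht, ht0⟩ := Submodule.exists_mem_ne_zero_of_ne_bot hker
  refine ⟨t, ht0, fun j => ?_⟩
  have := congrFun (LinearMap.mem_ker.1 ht) j
  simpa [Matrix.mulVec, dotProduct, mul_comm] using this

/-- If the contact set misses `(a, b)` while the support of `G` has more points in `(a, b)` than
there are linear constraints (mass, mean, and one for each `ψ j`), then `G` is a proper midpoint
of two contractions of `F` that satisfy the same constraints. -/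
theorem ConvexOrder.exists_perturbation {G F : Measure I} [IsProbabilityMeasure G]
    [IsFiniteMeasure F] (h : ConvexOrder G F) {κ : Type*} [Fintype κ] (ψ : κ → I → ℝ)
    (hψ : ∀ j, Continuous (ψ j)) {a b : I} (hgap : Disjoint (Set.Ioo a b) (contactSet G F))
    {s : Finset I} (hs : (s : Set I) ⊆ Set.Ioo a b) (hsupp : (s : Set I) ⊆ G.support)
    (hcard : Fintype.card κ + 2 < s.card) :
    ∃ k : I → ℝ, Measurable k ∧ (∀ ω, |k ω| ≤ 1) ∧ ∫ ω, k ω ∂G = 0 ∧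
      (∀ j, ∫ ω, k ω * ψ j ω ∂G = 0) ∧ ConvexOrder (tilt G k) F ∧
      ConvexOrder (tilt G fun ω => -k ω) F ∧
      ∃ N : Set I, MeasurableSet N ∧ ∫ ω in N, k ω ∂G ≠ 0 := by
  classical
  have hne : s.Nonempty := Finset.card_pos.1 (by omega)
  obtain ⟨a', haa', ha'⟩ : ∃ a', a < a' ∧ ∀ x ∈ s, a' < x := by
    obtain ⟨a', h1, h2⟩ := exists_between (hs (s.min'_mem hne)).1
    exact ⟨a', h1, fun x hx => h2.trans_le (s.min'_le x hx)⟩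
  obtain ⟨b', hbb', hb'⟩ : ∃ b', b' < b ∧ ∀ x ∈ s, x < b' := by
    obtain ⟨b', h1, h2⟩ := exists_between (hs (s.max'_mem hne)).2
    exact ⟨b', h2, fun x hx => (s.le_max' x hx).trans_lt h1⟩
  have hle : a' ≤ b' := by
    obtain ⟨x, hx⟩ := hne
    exact ((ha' x hx).trans (hb' x hx)).le
  -- on a compact part of the gap, the order constraint is slack by at least `δ`
  obtain ⟨δ, hδ0, hδ⟩ : ∃ δ : ℝ, 0 < δ ∧ ∀ x ∈ Set.Icc a' b', icdf G x + δ ≤ icdf F x := by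
    obtain ⟨x, hx, hmin⟩ := isCompact_Icc.exists_isMinOn (Set.nonempty_Icc.2 hle)
      ((continuous_icdf F).sub (continuous_icdf G)).continuousOn
    refine ⟨icdf F x - icdf G x, ?_, fun y hy => ?_⟩
    · have : x ∉ contactSet G F := Set.disjoint_left.1 hgap
        ⟨haa'.trans_le hx.1, hx.2.trans_lt hbb'⟩
      have := lt_of_not_ge (show ¬ icdf F x ≤ icdf G x from this)
      linarith
    · have : icdf F x - icdf G x ≤ icdf F y - icdf G y := hmin hy
      linarith
  obtain ⟨N₀, hN₀, hN₀d⟩ := s.finite_toSet.t2_separation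
  set N : s → Set I := fun i => N₀ i ∩ Set.Ioo a' b' with hN
  have hNm : ∀ i, MeasurableSet (N i) := fun i => ((hN₀ i).2.inter isOpen_Ioo).measurableSet
  have hNd : Pairwise fun i j => Disjoint (N i) (N j) := fun i j hij =>
    (hN₀d i.2 j.2 (fun h => hij (Subtype.ext h))).mono Set.inter_subset_left Set.inter_subset_left
  have hNpos : ∀ i, 0 < G.real (N i) := fun i => by
    refine ENNReal.toReal_pos ?_ (measure_ne_top _ _)
    refine ((Measure.mem_support_iff_forall _).1 (hsupp i.2) _ ?_).ne'
    exact ((hN₀ i).2.inter isOpen_Ioo).mem_nhds ⟨(hN₀ i).1, ha' i i.2, hb' i i.2⟩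
  -- one constraint for mass, one for the mean and one for every `ψ j`
  set Ψ : Option (Option κ) → I → ℝ := fun o =>
    o.elim (fun _ => 1) fun o => o.elim (fun ω => (ω : ℝ)) ψ with hΨ
  have hΨc : ∀ o, Continuous (Ψ o) := by
    rintro (_ | _ | j)
    · exact continuous_const
    · exact continuous_subtype_val
    · exact hψ j
  obtain ⟨t, ht0, ht⟩ := exists_ne_zero_sum_mul_eq_zero (ι := s) (κ := Option (Option κ))
    (by simpa using hcard) fun o i => ∫ ω in N i, Ψ o ω ∂G
  set S : ℝ := ∑ i, |t i| with hS
  have hS0 : 0 ≤ S := Finset.sum_nonneg fun i _ => abs_nonneg _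
  set ε : ℝ := min 1 δ / (S + 1) with hε
  have hε0 : 0 < ε := div_pos (lt_min one_pos hδ0) (by linarith)
  have hεS : ε * S ≤ min 1 δ := by
    calc ε * S ≤ ε * (S + 1) := mul_le_mul_of_nonneg_left (by linarith) hε0.le
      _ = min 1 δ := div_mul_cancel₀ _ (by linarith)
  set k : I → ℝ := fun ω => ε * ∑ i, t i * (N i).indicator 1 ω with hk
  have hkm : Measurable k := by
    refine Measurable.const_mul (Finset.measurable_sum _ fun i _ => ?_) _
    exact (measurable_one.indicator (hNm i)).const_mul _
  have hkb : ∀ ω, |k ω| ≤ min 1 δ := fun ω => by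
    refine le_trans ?_ hεS
    rw [hk, abs_mul, abs_of_pos hε0]
    refine mul_le_mul_of_nonneg_left ((Finset.abs_sum_le_sum_abs _ _).trans ?_) hε0.le
    refine Finset.sum_le_sum fun i _ => ?_
    rw [abs_mul]
    refine mul_le_of_le_one_right (abs_nonneg _) ?_
    by_cases hω : ω ∈ N i <;> simp [hω]
  have hk1 : ∀ ω, |k ω| ≤ 1 := fun ω => (hkb ω).trans (min_le_left _ _)
  have hkδ : ∀ ω, |k ω| ≤ δ := fun ω => (hkb ω).trans (min_le_right _ _)
  have hkint : ∀ φ : I → ℝ, Integrable φ G →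
      ∫ ω, k ω * φ ω ∂G = ε * ∑ i, t i * ∫ ω in N i, φ ω ∂G := fun φ hφ => by
    have : ∀ ω, k ω * φ ω = ε * ∑ i, t i * (N i).indicator φ ω := fun ω => by
      simp only [hk, mul_assoc, Finset.sum_mul]
      congr 1
      refine Finset.sum_congr rfl fun i _ => ?_
      by_cases hω : ω ∈ N i <;> simp [hω]
    simp only [this]
    rw [integral_const_mul, integral_finsetSum _ fun i _ => (hφ.indicator (hNm i)).const_mul _]
    simp only [integral_const_mul, integral_indicator (hNm _)]
  have hkΨ : ∀ o, ∫ ω, k ω * Ψ o ω ∂G = 0 := fun o => by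
    rw [hkint _ (integrable_of_continuous G (hΨc o)), ht o, mul_zero]
  have hk0 : ∫ ω, k ω ∂G = 0 := by simpa [hΨ] using hkΨ none
  have hkmean : ∫ ω, k ω * ω ∂G = 0 := hkΨ (some none)
  have hkout : ∀ ω ∉ Set.Ioo a' b', k ω = 0 := fun ω hω => by
    simp only [hk]
    rw [Finset.sum_eq_zero, mul_zero]
    intro i _
    rw [Set.indicator_of_notMem (fun h => hω h.2), mul_zero]
  refine ⟨k, hkm, hk1, hk0, fun j => hkΨ (some (some j)),
    h.left_tilt hkm hk1 hk0 hkmean hkout hkδ hδ, ?_, ?_⟩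
  · refine h.left_tilt hkm.neg (by simpa using hk1) ?_ ?_ (by simpa using hkout)
      (by simpa using hkδ) hδ
    · rw [integral_neg, hk0, neg_zero]
    · simp only [neg_mul]; rw [integral_neg, hkmean, neg_zero]
  · obtain ⟨i, hi⟩ := Function.ne_iff.1 ht0
    refine ⟨N i, hNm i, ?_⟩
    rw [setIntegral_congr_fun (g := fun _ => ε * t i) (hNm i)]
    · simp only [integral_const, smul_eq_mul, measureReal_restrict_apply_univ]
      exact mul_ne_zero (hNpos i).ne' (mul_ne_zero hε0.ne' hi)
    · intro ω hω
      simp only [hk]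
      rw [Finset.sum_eq_single i]
      · simp [hω]
      · intro j _ hj
        rw [Set.indicator_of_notMem (Set.disjoint_left.1 (hNd hj.symm) hω), mul_zero]
      · simp

/-! ### Optimal laws of posterior means -/

lemma continuous_integral (φ : I → ℝ) (hφ : Continuous φ) :
    Continuous fun G : ProbabilityMeasure I => ∫ ω, φ ω ∂(G : Measure I) :=
  ProbabilityMeasure.continuous_integral_continuousMap (⟨φ, hφ⟩ : C(I, ℝ))

lemma isClosed_convexOrder (F : Measure I) [IsProbabilityMeasure F] :
    IsClosed {G : ProbabilityMeasure I | ConvexOrder (G : Measure I) F} := by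
  have : {G : ProbabilityMeasure I | ConvexOrder (G : Measure I) F} =
      {G : ProbabilityMeasure I | ∫ ω, (ω : ℝ) ∂(G : Measure I) = ∫ ω, (ω : ℝ) ∂F} ∩
        ⋂ x : ℝ, {G : ProbabilityMeasure I | icdf (G : Measure I) x ≤ icdf F x} := by
    ext G
    simp only [Set.mem_ofPred_eq, Set.mem_inter_iff, Set.mem_iInter]
    exact ⟨fun h => ⟨h.mean, h.le⟩, fun h => ⟨by simp, h.1, h.2⟩⟩
  rw [this]
  refine (isClosed_eq (continuous_integral _ continuous_subtype_val) continuous_const).inter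
    (isClosed_iInter fun x => ?_)
  exact isClosed_le (continuous_integral _ (continuous_hockey x)) continuous_const

/-- Tuples of laws of posterior means, one for each type, that signals can induce and for which
no type gains by choosing the signal of another type; `U θ m` is the indirect utility of type `θ` at
posterior mean `m`. -/
def feasibleSet {n : ℕ} (F : Measure I) (U : Fin n → I → ℝ) : Set (Fin n → ProbabilityMeasure I) :=
  {G | (∀ θ, ConvexOrder (G θ : Measure I) F) ∧
    ∀ θ θ', ∫ ω, U θ ω ∂(G θ' : Measure I) ≤ ∫ ω, U θ ω ∂(G θ : Measure I)}

lemma isClosed_feasibleSet {n : ℕ} (F : Measure I) [IsProbabilityMeasure F] (U : Fin n → I → ℝ)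
    (hU : ∀ θ, Continuous (U θ)) : IsClosed (feasibleSet F U) := by
  have : feasibleSet F U = (⋂ θ, {G | ConvexOrder (G θ : Measure I) F}) ∩
      ⋂ θ, ⋂ θ', {G | ∫ ω, U θ ω ∂(G θ' : Measure I) ≤ ∫ ω, U θ ω ∂(G θ : Measure I)} := by
    ext G; simp [feasibleSet]
  rw [this]
  refine (isClosed_iInter fun θ => ?_).inter (isClosed_iInter fun θ => isClosed_iInter fun θ' => ?_)
  · exact (isClosed_convexOrder F).preimage
      (continuous_apply (A := fun _ : Fin n => ProbabilityMeasure I) θ)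
  · exact isClosed_le ((continuous_integral _ (hU θ)).comp (continuous_apply θ'))
      ((continuous_integral _ (hU θ)).comp (continuous_apply θ))

/-- `V` is a pointwise limit from above of the uniformly bounded continuous functions `W k`. This
makes `V` upper semicontinuous, hence also its integral as a function of the measure. -/
structure IsLimitFromAbove (V : I → ℝ) (W : ℕ → I → ℝ) : Prop where
  continuous : ∀ k, Continuous (W k)
  le : ∀ k ω, V ω ≤ W k ω
  tendsto : ∀ ω, Filter.Tendsto (fun k => W k ω) Filter.atTop (nhds (V ω))
  bdd : ∃ B : ℝ, ∀ k ω, |W k ω| ≤ B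

namespace IsLimitFromAbove

variable {V : I → ℝ} {W : ℕ → I → ℝ} (h : IsLimitFromAbove V W)
include h

lemma measurable : Measurable V :=
  measurable_of_tendsto_metrizable (fun k => (h.continuous k).measurable)
    (tendsto_pi_nhds.2 h.tendsto)

lemma integrable (G : Measure I) [IsFiniteMeasure G] : Integrable V G := by
  obtain ⟨B, hB⟩ := h.bdd
  refine Integrable.of_bound h.measurable.aestronglyMeasurable B (.of_forall fun ω => ?_)
  exact le_of_tendsto (h.tendsto ω).abs (.of_forall fun k => hB k ω)

lemma tendsto_integral (G : Measure I) [IsFiniteMeasure G] :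
    Filter.Tendsto (fun k => ∫ ω, W k ω ∂G) Filter.atTop (nhds (∫ ω, V ω ∂G)) := by
  obtain ⟨B, hB⟩ := h.bdd
  exact tendsto_integral_of_dominated_convergence (fun _ => B)
    (fun k => (h.continuous k).aestronglyMeasurable) (integrable_const B)
    (fun k => .of_forall fun ω => hB k ω) (.of_forall h.tendsto)

lemma upperSemicontinuous_integral :
    UpperSemicontinuous fun G : ProbabilityMeasure I => ∫ ω, V ω ∂(G : Measure I) := by
  intro G y hy
  obtain ⟨k, hk⟩ := ((h.tendsto_integral (G : Measure I)).eventually (gt_mem_nhds hy)).exists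
  filter_upwards [((continuous_integral _ (h.continuous k)).tendsto G).eventually
    (gt_mem_nhds hk)] with G' hG'
  exact (integral_mono (h.integrable _) (integrable_of_continuous _ (h.continuous k))
    (h.le k)).trans_lt hG'

end IsLimitFromAbove

/-- The designer's problem over laws of posterior means has a solution, and it can be chosen with at
most `n + 2` atoms on each gap of the contact set: the maximizers form a compact set, embedded in a
locally convex space by the integrals of continuous functions, and at an extreme point of it
no perturbation of the law of a single type is possible that keeps the `n` indirect utilities. -/
theorem exists_optimal_extremal {n : ℕ} (F : Measure I) [IsProbabilityMeasure F]
    (g : Fin n → ℝ) (hg : ∀ θ, 0 ≤ g θ) (U V : Fin n → I → ℝ) (W : Fin n → ℕ → I → ℝ)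
    (hU : ∀ θ, Continuous (U θ)) (hV : ∀ θ, IsLimitFromAbove (V θ) (W θ)) :
    ∃ G ∈ feasibleSet F U,
      (∀ G' ∈ feasibleSet F U, ∑ θ, g θ * ∫ ω, V θ ω ∂(G' θ : Measure I) ≤
        ∑ θ, g θ * ∫ ω, V θ ω ∂(G θ : Measure I)) ∧
      ∀ θ, ∀ a b, IsGap (contactSet (G θ : Measure I) F) a b →
        ∃ s : Finset I, (s : Set I) ⊆ Set.Ioo a b ∧ s.card ≤ n + 2 ∧
          (G θ : Measure I) (Set.Ioo a b \ s) = 0 := by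
  classical
  set P : (Fin n → ProbabilityMeasure I) → ℝ :=
    fun G => ∑ θ, g θ * ∫ ω, V θ ω ∂(G θ : Measure I) with hP
  have hPusc : UpperSemicontinuous P := by
    refine upperSemicontinuous_sum fun θ _ => ?_
    have h1 : UpperSemicontinuous fun G : Fin n → ProbabilityMeasure I =>
        ∫ ω, V θ ω ∂(G θ : Measure I) :=
      (hV θ).upperSemicontinuous_integral.comp (continuous_apply θ)
    exact (continuous_const.mul continuous_id).comp_upperSemicontinuous h1
      (fun x y hxy => mul_le_mul_of_nonneg_left hxy (hg θ))
  have hKc : IsCompact (feasibleSet F U) := (isClosed_feasibleSet F U hU).isCompact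
  have hKne : (feasibleSet F U).Nonempty :=
    ⟨fun _ => ⟨F, inferInstance⟩, fun θ => ⟨rfl, rfl, fun _ => le_rfl⟩, fun θ θ' => le_rfl⟩
  obtain ⟨G₀, hG₀, hmax⟩ :=
    UpperSemicontinuousOn.exists_isMaxOn hKne hKc (hPusc.upperSemicontinuousOn _)
  set 𝒜 := feasibleSet F U ∩ P ⁻¹' Set.Ici (P G₀) with h𝒜
  have h𝒜c : IsCompact 𝒜 := hKc.inter_right (hPusc.isClosed_preimage _)
  set e : (Fin n → ProbabilityMeasure I) → Fin n → C(I, ℝ) → ℝ :=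
    fun G θ φ => ∫ ω, φ ω ∂(G θ : Measure I) with he
  have hec : Continuous e := continuous_pi fun θ => continuous_pi fun φ =>
    (continuous_integral φ φ.continuous).comp (continuous_apply θ)
  have h𝒜ne : 𝒜.Nonempty := ⟨G₀, hG₀, show P G₀ ≤ P G₀ from le_rfl⟩
  obtain ⟨_, ⟨G, hG𝒜, rfl⟩, hext⟩ :=
    (h𝒜c.image hec).extremePoints_nonempty (h𝒜ne.image e)
  refine ⟨G, hG𝒜.1, fun G' hG' => (hmax hG').trans hG𝒜.2, fun θ a b hgap => ?_⟩
  set s := (G θ : Measure I).support ∩ Set.Ioo a b with hs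
  by_cases hcard : s.encard ≤ n + 2
  · have hfin : s.Finite := Set.finite_of_encard_le_coe (k := n + 2) (by exact_mod_cast hcard)
    refine ⟨hfin.toFinset, by simp [hs], ?_, ?_⟩
    · rw [hfin.encard_eq_coe_toFinset_card] at hcard
      exact_mod_cast hcard
    · refine measure_mono_null (t := (G θ : Measure I).supportᶜ) (fun x hx hx' => ?_)
        Measure.measure_compl_support
      exact hx.2 (by simpa using ⟨hx', hx.1⟩)
  exfalso
  obtain ⟨s', hs's, hs'card⟩ := Set.exists_subset_encard_eq
    (Order.add_one_le_of_lt (not_le.1 hcard))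
  have hs'fin : s'.Finite := Set.finite_of_encard_eq_coe (k := n + 2 + 1)
    (by exact_mod_cast hs'card)
  rw [hs'fin.encard_eq_coe_toFinset_card] at hs'card
  have hs'c : hs'fin.toFinset.card = n + 2 + 1 := by exact_mod_cast hs'card
  obtain ⟨k, hkm, hk1, hk0, hkU, hord, hord', N, hNm, hN⟩ :=
    (hG𝒜.1.1 θ).exists_perturbation U hU hgap.disjoint (s := hs'fin.toFinset)
      (by simpa using hs's.trans Set.inter_subset_right)
      (by simpa using hs's.trans Set.inter_subset_left)
      (by simp [hs'c])
  have hk1' : ∀ ω, |-k ω| ≤ 1 := by simpa using hk1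
  have hk0' : ∫ ω, -k ω ∂(G θ : Measure I) = 0 := by rw [integral_neg, hk0, neg_zero]
  set G₁ : ProbabilityMeasure I :=
    ⟨tilt (G θ) k, isProbabilityMeasure_tilt hkm hk1 hk0⟩ with hG₁
  set G₂ : ProbabilityMeasure I :=
    ⟨tilt (G θ) fun ω => -k ω, isProbabilityMeasure_tilt hkm.neg hk1' hk0'⟩ with hG₂
  have hint₁ : ∀ φ : I → ℝ, Integrable φ (G θ : Measure I) → ∫ ω, φ ω ∂(G₁ : Measure I) =
      ∫ ω, φ ω ∂(G θ : Measure I) + ∫ ω, k ω * φ ω ∂(G θ : Measure I) := fun φ hφ =>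
    integral_tilt hkm hk1 hφ
  have hint₂ : ∀ φ : I → ℝ, Integrable φ (G θ : Measure I) → ∫ ω, φ ω ∂(G₂ : Measure I) =
      ∫ ω, φ ω ∂(G θ : Measure I) - ∫ ω, k ω * φ ω ∂(G θ : Measure I) := fun φ hφ => by
    refine (integral_tilt hkm.neg hk1' hφ).trans ?_
    rw [sub_eq_add_neg, ← integral_neg]
    simp only [Pi.neg_apply, neg_mul]
  -- the perturbed tuples stay feasible, because no type's utility changes
  have hfeas : ∀ G' : ProbabilityMeasure I, ConvexOrder (G' : Measure I) F →
      (∀ η, ∫ ω, U η ω ∂(G' : Measure I) = ∫ ω, U η ω ∂(G θ : Measure I)) →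
      Function.update G θ G' ∈ feasibleSet F U := by
    intro G' hG' hU'
    have heq : ∀ η θ', ∫ ω, U η ω ∂(Function.update G θ G' θ' : Measure I) =
        ∫ ω, U η ω ∂(G θ' : Measure I) := fun η θ' => by
      by_cases h : θ' = θ
      · subst h; simp [hU']
      · simp [h]
    refine ⟨fun θ' => ?_, fun η θ' => ?_⟩
    · by_cases h : θ' = θ
      · subst h; simpa using hG'
      · simpa [h] using hG𝒜.1.1 θ'
    · rw [heq, heq]; exact hG𝒜.1.2 η θ'
  have hUi : ∀ η, Integrable (U η) (G θ : Measure I) := fun η => integrable_of_continuous _ (hU η)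
  have hf₁ := hfeas G₁ hord fun η => by rw [hint₁ _ (hUi η), hkU, add_zero]
  have hf₂ := hfeas G₂ hord' fun η => by rw [hint₂ _ (hUi η), hkU, sub_zero]
  have hPupd : ∀ G' : ProbabilityMeasure I, P (Function.update G θ G') =
      P G + g θ * (∫ ω, V θ ω ∂(G' : Measure I) - ∫ ω, V θ ω ∂(G θ : Measure I)) := fun G' => by
    simp only [hP]
    rw [← Finset.add_sum_erase _ _ (Finset.mem_univ θ),
      ← Finset.add_sum_erase (a := θ) _ (fun θ => g θ * ∫ ω, V θ ω ∂(G θ : Measure I))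
        (Finset.mem_univ θ)]
    rw [Finset.sum_congr rfl fun θ' hθ' => by
      rw [Function.update_of_ne (Finset.ne_of_mem_erase hθ')]]
    simp only [Function.update_self]
    ring
  have hPG : P G₀ ≤ P G := hG𝒜.2
  have hP₁ := hPupd G₁
  have hP₂ := hPupd G₂
  rw [hint₁ _ ((hV θ).integrable _)] at hP₁
  rw [hint₂ _ ((hV θ).integrable _)] at hP₂
  have hm₁ : P (Function.update G θ G₁) ≤ P G₀ := hmax hf₁
  have hm₂ : P (Function.update G θ G₂) ≤ P G₀ := hmax hf₂
  have hA₁ : Function.update G θ G₁ ∈ 𝒜 := ⟨hf₁, show P G₀ ≤ _ by linarith⟩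
  have hA₂ : Function.update G θ G₂ ∈ 𝒜 := ⟨hf₂, show P G₀ ≤ _ by linarith⟩
  have hmid : e G ∈ openSegment ℝ (e (Function.update G θ G₁)) (e (Function.update G θ G₂)) := by
    refine ⟨1 / 2, 1 / 2, by norm_num, by norm_num, by norm_num, ?_⟩
    ext θ' φ
    simp only [he, Pi.add_apply, Pi.smul_apply, smul_eq_mul]
    by_cases h : θ' = θ
    · subst h
      have hφ := integrable_of_continuous (G θ' : Measure I) φ.continuous
      simp only [Function.update_self]
      rw [hint₁ _ hφ, hint₂ _ hφ]
      ring
    · simp only [Function.update_of_ne h]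
      ring
  have he₁ := hext ⟨_, hA₁, rfl⟩ ⟨_, hA₂, rfl⟩ hmid
  have hmeas : (G₁ : Measure I) = G θ := by
    refine ext_of_forall_integral_eq_of_IsFiniteMeasure fun φ => ?_
    have := congrFun (congrFun he₁ θ) φ.toContinuousMap
    simpa [he] using this
  have h1 := hint₁ (N.indicator 1) ((integrable_const (1 : ℝ)).indicator hNm)
  rw [hmeas] at h1
  apply hN
  rw [← integral_indicator hNm]
  have h2 : ∀ ω, k ω * N.indicator 1 ω = N.indicator k ω := fun ω => by
    by_cases hω : ω ∈ N <;> simp [hω]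
  simp only [h2] at h1
  linarith

section Argmax

variable {A : Type uA} [TopologicalSpace A]

/-! ### Measurable selection of optimal actions -/

/-- The maximizers of `h` on `S`. -/
def argmaxOn (S : Set A) (h : A → ℝ) : Set A := {a | a ∈ S ∧ h a = sSup (h '' S)}

lemma isClosed_argmaxOn {S : Set A} (hS : IsClosed S) {h : A → ℝ} (hh : Continuous h) :
    IsClosed (argmaxOn S h) :=
  hS.inter (isClosed_eq hh continuous_const)

lemma continuous_penalty {f h : I → A → ℝ} (hf : Continuous (Function.uncurry f))
    (hh : Continuous (Function.uncurry h)) (k : ℕ) :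
    Continuous (Function.uncurry fun m a => f m a + k * h m a) :=
  hf.add (continuous_const.mul hh)

variable [CompactSpace A]

lemma bddAbove_image_of_continuous {h : A → ℝ} (hh : Continuous h) (S : Set A) :
    BddAbove (h '' S) :=
  (isCompact_univ.bddAbove_image hh.continuousOn).mono (Set.image_mono (Set.subset_univ S))

lemma le_sSup_image {h : A → ℝ} (hh : Continuous h) {S : Set A} {a : A} (ha : a ∈ S) :
    h a ≤ sSup (h '' S) :=
  le_csSup (bddAbove_image_of_continuous hh S) ⟨a, ha, rfl⟩

lemma argmaxOn_nonempty {S : Set A} (hS : IsClosed S) (hne : S.Nonempty) {h : A → ℝ}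
    (hh : Continuous h) : (argmaxOn S h).Nonempty := by
  obtain ⟨a, ha, heq⟩ := hS.isCompact.exists_sSup_image_eq hne hh.continuousOn
  exact ⟨a, ha, heq.symm⟩

lemma le_penalized {S : Set A} {f h : A → ℝ} (hf : Continuous f) (hh : Continuous h) {a : A}
    (ha : a ∈ argmaxOn S h) (k : ℕ) :
    f a ≤ sSup ((fun a => f a + k * h a) '' S) - k * sSup (h '' S) := by
  have := le_sSup_image (h := fun a => f a + k * h a) (by fun_prop) ha.1
  simp only [ha.2] at this
  linarith

lemma penalized_le {S : Set A} (hne : S.Nonempty) {f h : A → ℝ} (hf : Continuous f)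
    (hh : Continuous h) (k : ℕ) :
    sSup ((fun a => f a + k * h a) '' S) - k * sSup (h '' S) ≤ sSup (f '' S) := by
  rw [sub_le_iff_le_add]
  refine csSup_le (hne.image _) ?_
  rintro _ ⟨a, ha, rfl⟩
  exact add_le_add (le_sSup_image hf ha)
    (mul_le_mul_of_nonneg_left (le_sSup_image hh ha) (Nat.cast_nonneg k))

/-- The maximum of `f` over the maximizers of `h` is the limit of the penalized problems in which
`h` gets an ever larger weight. -/
lemma tendsto_penalized {S : Set A} (hS : IsClosed S) (hne : S.Nonempty) {f h : A → ℝ}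
    (hf : Continuous f) (hh : Continuous h) :
    Filter.Tendsto (fun k : ℕ => sSup ((fun a => f a + k * h a) '' S) - k * sSup (h '' S))
      Filter.atTop (nhds (sSup (f '' argmaxOn S h))) := by
  have hne' := argmaxOn_nonempty hS hne hh
  set y := sSup (f '' argmaxOn S h) with hy
  have hlow : ∀ k : ℕ, y ≤ sSup ((fun a => f a + k * h a) '' S) - k * sSup (h '' S) := fun k => by
    refine csSup_le (hne'.image _) ?_
    rintro _ ⟨a, ha, rfl⟩
    exact le_penalized hf hh ha k
  refine tendsto_order.2 ⟨fun z hz => .of_forall fun k => hz.trans_le (hlow k), fun z hz => ?_⟩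
  obtain ⟨w, hyw, hwz⟩ := exists_between hz
  -- the points of `S` where `f` exceeds `w` miss the maximum of `h` by a fixed margin
  set D := S ∩ {a | w ≤ f a} with hD
  have hDc : IsClosed D := hS.inter (isClosed_le continuous_const hf)
  obtain ⟨K, hK⟩ : ∃ K : ℕ, ∀ k ≥ K, ∀ a ∈ D, f a + k * h a ≤ w + k * sSup (h '' S) := by
    rcases D.eq_empty_or_nonempty with hDe | hDne
    · exact ⟨0, fun k _ a ha => by simp [hDe] at ha⟩
    obtain ⟨a₀, ha₀, hmax⟩ := hDc.isCompact.exists_isMaxOn hDne hh.continuousOn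
    have hlt : h a₀ < sSup (h '' S) := by
      refine lt_of_le_of_ne (le_sSup_image hh ha₀.1) fun heq => ?_
      have : f a₀ ≤ y := le_sSup_image hf ⟨ha₀.1, heq⟩
      exact absurd (ha₀.2 : w ≤ f a₀) (not_le.2 (this.trans_lt hyw))
    obtain ⟨K, hK⟩ := exists_nat_ge ((sSup (f '' S) - w) / (sSup (h '' S) - h a₀))
    refine ⟨K, fun k hk a ha => ?_⟩
    have h1 : h a ≤ h a₀ := hmax ha
    have h2 : f a ≤ sSup (f '' S) := le_sSup_image hf ha.1
    have hk' : (K : ℝ) ≤ k := by exact_mod_cast hk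
    have h3 : sSup (f '' S) - w ≤ k * (sSup (h '' S) - h a₀) :=
      (div_le_iff₀ (by linarith)).1 (hK.trans hk')
    have h4 : (k : ℝ) * h a ≤ k * h a₀ := mul_le_mul_of_nonneg_left h1 (Nat.cast_nonneg k)
    linarith
  filter_upwards [Filter.eventually_ge_atTop K] with k hk
  refine lt_of_le_of_lt ?_ hwz
  rw [sub_le_iff_le_add]
  refine csSup_le (hne.image _) ?_
  rintro _ ⟨a, ha, rfl⟩
  by_cases haw : w ≤ f a
  · exact hK k hk a ⟨ha, haw⟩
  · exact add_le_add (not_le.1 haw).le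
      (mul_le_mul_of_nonneg_left (le_sSup_image hh ha) (Nat.cast_nonneg k))

/-- A family of nonempty closed sets of actions over which maxima of continuous functions depend
measurably on the posterior mean. -/
structure IsMeasurableFamily (S : I → Set A) : Prop where
  isClosed : ∀ m, IsClosed (S m)
  nonempty : ∀ m, (S m).Nonempty
  measurable : ∀ f : I → A → ℝ, Continuous (Function.uncurry f) →
    Measurable fun m => sSup (f m '' S m)

lemma continuous_sSup_image_univ {f : I → A → ℝ} (hf : Continuous (Function.uncurry f)) :
    Continuous fun m => sSup (f m '' Set.univ) :=
  isCompact_univ.continuous_sSup hf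

lemma isMeasurableFamily_univ [Nonempty A] :
    IsMeasurableFamily fun _ : I => (Set.univ : Set A) :=
  ⟨fun _ => isClosed_univ, fun _ => Set.univ_nonempty,
    fun _ hf => (continuous_sSup_image_univ hf).measurable⟩

lemma IsMeasurableFamily.argmaxOn {S : I → Set A} (hS : IsMeasurableFamily S) {h : I → A → ℝ}
    (hh : Continuous (Function.uncurry h)) :
    IsMeasurableFamily fun m => argmaxOn (S m) (h m) := by
  have hc : ∀ {f : I → A → ℝ}, Continuous (Function.uncurry f) → ∀ m, Continuous (f m) :=
    fun hf m => hf.comp (by fun_prop : Continuous fun a => (m, a))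
  refine ⟨fun m => isClosed_argmaxOn (hS.isClosed m) (hc hh m),
    fun m => argmaxOn_nonempty (hS.isClosed m) (hS.nonempty m) (hc hh m), fun f hf => ?_⟩
  exact measurable_of_tendsto_metrizable
    (fun k : ℕ => (hS.measurable _ (continuous_penalty hf hh k)).sub
      ((hS.measurable _ hh).const_mul (k : ℝ)))
    (tendsto_pi_nhds.2 fun m =>
      tendsto_penalized (hS.isClosed m) (hS.nonempty m) (hc hf m) (hc hh m))

variable [Nonempty A]

/-- There is a receiver-optimal action `α m` for every posterior mean `m` that breaks ties in
favour of the designer and has measurable payoff coefficients. The designer's payoff from it is a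
limit from above of continuous functions `W k`, which also bound what the designer gets from any
other optimal action. Ties that remain are broken in favour of `u₁` and `v₁`; the action itself
need not be measurable, as `A` carries no measurable structure. -/
theorem exists_measurable_argmax {u₁ u₂ v₁ v₂ : A → ℝ} (hu₁ : Continuous u₁) (hu₂ : Continuous u₂)
    (hv₁ : Continuous v₁) (hv₂ : Continuous v₂) :
    ∃ (α : I → A) (W : ℕ → I → ℝ),
      (∀ (m : I) b, u₁ b * (m : ℝ) + u₂ b ≤ u₁ (α m) * m + u₂ (α m)) ∧
      Measurable (fun m => u₁ (α m)) ∧ Measurable (fun m => u₂ (α m)) ∧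
      Measurable (fun m => v₁ (α m)) ∧ Measurable (fun m => v₂ (α m)) ∧
      IsLimitFromAbove (fun m => v₁ (α m) * m + v₂ (α m)) W ∧
      ∀ (m : I) b, (∀ c, u₁ c * (m : ℝ) + u₂ c ≤ u₁ b * m + u₂ b) →
        ∀ k, v₁ b * (m : ℝ) + v₂ b ≤ W k m := by
  set u : I → A → ℝ := fun m a => u₁ a * m + u₂ a with hu
  set v : I → A → ℝ := fun m a => v₁ a * m + v₂ a with hv
  have huc : Continuous (Function.uncurry u) := by
    simp only [hu, Function.uncurry_def]; fun_prop
  have hvc : Continuous (Function.uncurry v) := by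
    simp only [hv, Function.uncurry_def]; fun_prop
  have hum : ∀ m, Continuous (u m) := fun m => by simp only [hu]; fun_prop
  have hvm : ∀ m, Continuous (v m) := fun m => by simp only [hv]; fun_prop
  have hu₁c : Continuous (Function.uncurry fun (_ : I) a => u₁ a) := by
    simp only [Function.uncurry_def]; fun_prop
  have hv₁c : Continuous (Function.uncurry fun (_ : I) a => v₁ a) := by
    simp only [Function.uncurry_def]; fun_prop
  -- lexicographic maximization of `u`, `v`, `u₁`, `v₁` determines all payoff coefficients
  have hS₀ := isMeasurableFamily_univ (A := A)
  have hS₁ := hS₀.argmaxOn huc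
  have hS₂ := hS₁.argmaxOn hvc
  have hS₃ := hS₂.argmaxOn hu₁c
  have hS₄ := hS₃.argmaxOn hv₁c
  choose α hα using hS₄.nonempty
  have e₄ : ∀ m, v₁ (α m) = _ := fun m => (hα m).2
  have e₃ : ∀ m, u₁ (α m) = _ := fun m => (hα m).1.2
  have e₂ : ∀ m, v m (α m) = _ := fun m => (hα m).1.1.2
  have e₁ : ∀ m, u m (α m) = _ := fun m => (hα m).1.1.1.2
  have m₁ : Measurable fun m => u m (α m) := by
    simp only [e₁]; exact hS₀.measurable _ huc
  have m₂ : Measurable fun m => v m (α m) := by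
    simp only [e₂]; exact hS₁.measurable _ hvc
  have m₃ : Measurable fun m => u₁ (α m) := by
    simp only [e₃]; exact hS₂.measurable _ hu₁c
  have m₄ : Measurable fun m => v₁ (α m) := by
    simp only [e₄]; exact hS₃.measurable _ hv₁c
  have hcoe : Measurable fun m : I => (m : ℝ) := measurable_subtype_coe
  set W : ℕ → I → ℝ := fun k m =>
    sSup ((fun a => v m a + k * u m a) '' Set.univ) - k * sSup (u m '' Set.univ) with hW
  have hWle : ∀ (m : I) b, (∀ c, u m c ≤ u m b) → ∀ k, v m b ≤ W k m := fun m b hb k => by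
    refine le_penalized (hvm m) (hum m) ⟨Set.mem_univ b, le_antisymm
      (le_sSup_image (hum m) (Set.mem_univ b)) (csSup_le (Set.univ_nonempty.image _) ?_)⟩ k
    rintro _ ⟨c, -, rfl⟩
    exact hb c
  have hopt : ∀ m b, u m b ≤ u m (α m) := fun m b => by
    rw [e₁ m]; exact le_sSup_image (hum m) (Set.mem_univ b)
  obtain ⟨B₁, hB₁⟩ := isCompact_univ.exists_bound_of_continuousOn hv₁.continuousOn
  obtain ⟨B₂, hB₂⟩ := isCompact_univ.exists_bound_of_continuousOn hv₂.continuousOn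
  have hvB : ∀ m a, |v m a| ≤ B₁ + B₂ := fun m a => by
    refine (abs_add_le _ _).trans (add_le_add ?_ (hB₂ a (Set.mem_univ a)))
    rw [abs_mul, abs_of_nonneg m.2.1]
    exact (mul_le_of_le_one_right (abs_nonneg _) m.2.2).trans (hB₁ a (Set.mem_univ a))
  refine ⟨α, W, hopt, m₃, ?_, m₄, ?_, ⟨fun k => ?_, fun k m => hWle m (α m) (hopt m) k,
    fun m => ?_, B₁ + B₂, fun k m => abs_le.2 ⟨?_, ?_⟩⟩, hWle⟩
  · have : (fun m => u₂ (α m)) = fun m => u m (α m) - u₁ (α m) * m := by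
      ext m; simp only [hu]; ring
    rw [this]; exact m₁.sub (m₃.mul hcoe)
  · have : (fun m => v₂ (α m)) = fun m => v m (α m) - v₁ (α m) * m := by
      ext m; simp only [hv]; ring
    rw [this]; exact m₂.sub (m₄.mul hcoe)
  · exact (continuous_sSup_image_univ (continuous_penalty hvc huc k)).sub
      (continuous_const.mul (continuous_sSup_image_univ huc))
  · change Filter.Tendsto (fun k => W k m) Filter.atTop (nhds (v m (α m)))
    rw [e₂ m]
    exact tendsto_penalized isClosed_univ Set.univ_nonempty (hvm m) (hum m)
  · exact (abs_le.1 (hvB m (α m))).1.trans (hWle m (α m) (hopt m) k)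
  · refine (penalized_le Set.univ_nonempty (hvm m) (hum m) k).trans
      (csSup_le (Set.univ_nonempty.image _) ?_)
    rintro _ ⟨a, -, rfl⟩
    exact (abs_le.1 (hvB m a)).2

end Argmax

/-! ### Signals and their laws of posterior means -/

namespace Signal

variable (μ : Signal.{uS}) (F : Measure I) [IsProbabilityMeasure F]

instance isProbabilityMeasure_law : IsProbabilityMeasure (μ.law F) := by
  unfold law; infer_instance

instance isProbabilityMeasure_belief (s : μ.Msg) : IsProbabilityMeasure (μ.belief F s) := by
  unfold belief; infer_instance

/-- The joint law of message and state can be disintegrated in both directions. -/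
lemma integral_integral_belief {f : μ.Msg × I → ℝ} (hf : Measurable f) {B : ℝ}
    (hB : ∀ x, |f x| ≤ B) :
    ∫ s, ∫ ω, f (s, ω) ∂(μ.belief F s) ∂(μ.law F) = ∫ ω, ∫ s, f (s, ω) ∂(μ.kernel ω) ∂F := by
  have hf' : ∀ (ν : Measure (μ.Msg × I)) [IsFiniteMeasure ν], Integrable f ν := fun ν _ =>
    Integrable.of_bound hf.aestronglyMeasurable B (.of_forall hB)
  have h1 := Measure.integral_compProd (κ := μ.kernel†F) (hf' ((μ.kernel ∘ₘ F) ⊗ₘ (μ.kernel†F)))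
  have h2 := Measure.integral_compProd (μ := F) (κ := μ.kernel) (f := fun x => f x.swap)
    (Integrable.of_bound (hf.comp measurable_swap).aestronglyMeasurable B
      (.of_forall fun x => hB _))
  refine h1.symm.trans (Eq.trans ?_ h2)
  rw [compProd_posterior_eq_map_swap, integral_map measurable_swap.aemeasurable
    hf.aestronglyMeasurable]

/-- The law of iterated expectations. -/
lemma integral_expect {φ : I → ℝ} (hφ : Measurable φ) {B : ℝ} (hB : ∀ x, |φ x| ≤ B) :
    ∫ s, μ.expect F φ s ∂(μ.law F) = ∫ ω, φ ω ∂F := by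
  refine (μ.integral_integral_belief F (f := fun x => φ x.2) (hφ.comp measurable_snd)
    (fun x => hB _)).trans ?_
  simp

/-- The posterior mean of the state, as an element of the state space. -/
def posteriorMean (s : μ.Msg) : I :=
  ⟨μ.expect F (fun ω => (ω : ℝ)) s, integral_nonneg fun ω => ω.2.1, by
    calc μ.expect F (fun ω => (ω : ℝ)) s ≤ ∫ _, (1 : ℝ) ∂(μ.belief F s) :=
          integral_mono (integrable_coe _) (integrable_const _) fun ω => ω.2.2
      _ = 1 := by simp⟩

lemma coe_posteriorMean (s : μ.Msg) :
    (μ.posteriorMean F s : ℝ) = μ.expect F (fun ω => (ω : ℝ)) s := rfl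

lemma measurable_expect {φ : I → ℝ} (hφ : Measurable φ) : Measurable (μ.expect F φ) :=
  (StronglyMeasurable.integral_kernel (κ := μ.kernel†F) hφ.stronglyMeasurable).measurable

lemma measurable_posteriorMean : Measurable (μ.posteriorMean F) :=
  (μ.measurable_expect F measurable_subtype_coe).subtype_mk

lemma expect_affine (c d : ℝ) (s : μ.Msg) :
    μ.expect F (fun ω => c * (ω : ℝ) + d) s = c * μ.posteriorMean F s + d := by
  rw [expect, integral_add ((integrable_coe _).const_mul c) (integrable_const d),
    integral_const_mul, coe_posteriorMean, expect]
  simp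

/-- The distribution of the posterior mean. -/
def meanLaw : Measure I := (μ.law F).map (μ.posteriorMean F)

instance isProbabilityMeasure_meanLaw : IsProbabilityMeasure (μ.meanLaw F) :=
  Measure.isProbabilityMeasure_map (μ.measurable_posteriorMean F).aemeasurable

lemma integral_meanLaw {φ : I → ℝ} (hφ : Measurable φ) :
    ∫ m, φ m ∂(μ.meanLaw F) = ∫ s, φ (μ.posteriorMean F s) ∂(μ.law F) :=
  integral_map (μ.measurable_posteriorMean F).aemeasurable hφ.aestronglyMeasurable

/-- The posterior mean is a mean-preserving contraction of the state, by Jensen's inequality. -/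
theorem convexOrder_meanLaw : ConvexOrder (μ.meanLaw F) F := by
  refine ⟨by simp, ?_, fun x => ?_⟩
  · rw [μ.integral_meanLaw F measurable_subtype_coe]
    exact μ.integral_expect F measurable_subtype_coe (B := 1)
      fun ω => by rw [abs_of_nonneg ω.2.1]; exact ω.2.2
  · rw [icdf, μ.integral_meanLaw F (continuous_hockey x).measurable]
    have hm := (continuous_hockey x).measurable
    have hb : ∀ ω : I, |max (x - (ω : ℝ)) 0| ≤ |x| := fun ω => by
      rw [abs_of_nonneg (le_max_right _ _)]
      exact max_le (by linarith [le_abs_self x, ω.2.1]) (abs_nonneg _)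
    calc ∫ s, max (x - (μ.posteriorMean F s : ℝ)) 0 ∂(μ.law F)
        ≤ ∫ s, μ.expect F (fun ω => max (x - (ω : ℝ)) 0) s ∂(μ.law F) := by
          refine integral_mono ?_ ?_ fun s => max_le ?_ (integral_nonneg fun ω => le_max_right _ _)
          · exact Integrable.of_bound
              (hm.comp (μ.measurable_posteriorMean F)).aestronglyMeasurable |x|
              (.of_forall fun s => hb _)
          · refine Integrable.of_bound (μ.measurable_expect F hm).aestronglyMeasurable |x|
              (.of_forall fun s => ?_)
            refine (norm_integral_le_of_norm_le_const (.of_forall hb)).trans ?_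
            simp
          · rw [coe_posteriorMean, expect]
            have h1 := integral_const_sub (μ.belief F s) x
            rw [probReal_univ, mul_one] at h1
            rw [← h1]
            exact integral_mono ((integrable_const x).sub (integrable_coe _))
              (integrable_hockey _ x) fun ω => le_max_left _ _
      _ = icdf F x := μ.integral_expect F hm hb

lemma value_eq {A : Type uA} {w₁ w₂ : A → ℝ} {w : A → I → ℝ}
    (hw : ∀ a ω, w a ω = w₁ a * (ω : ℝ) + w₂ a)
    (hm : Measurable fun m : I => sSup ((fun a => w₁ a * (m : ℝ) + w₂ a) '' Set.univ)) :
    μ.value F w = ∫ m, sSup ((fun a => w₁ a * (m : ℝ) + w₂ a) '' Set.univ) ∂(μ.meanLaw F) := by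
  rw [μ.integral_meanLaw F hm, value]
  congr 1; ext s
  rw [Set.image_univ, sSup_range]
  congr 1; ext b
  rw [← μ.expect_affine F]
  congr 1; ext ω
  exact hw b ω

/-- The signal that sends the message `T ω` in state `ω`. The message space is a copy of the state
space in the required universe. -/
abbrev ofMap (T : I → I) (hT : Measurable T) : Signal.{uS} where
  Msg := ULift.{uS} I
  kernel := Kernel.deterministic (fun ω => ULift.up (T ω)) (measurable_up.comp hT)

lemma law_ofMap (F : Measure I) {T : I → I} (hT : Measurable T) :
    (ofMap.{uS} T hT).law F = F.map fun ω => ULift.up (T ω) :=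
  Measure.deterministic_comp_eq_map (measurable_up.comp hT)

variable {T : I → I} (hT : Measurable T)

/-- If `T` preserves first moments, then its messages are posterior means. -/
lemma posteriorMean_ofMap_ae (hT' : (firstMoment F).map T = firstMoment (F.map T)) :
    ∀ᵐ s ∂((ofMap.{uS} T hT).law F), (ofMap.{uS} T hT).posteriorMean F s = s.down := by
  set μ := ofMap.{uS} T hT with hμ
  have hprob : IsProbabilityMeasure (μ.law F) := μ.isProbabilityMeasure_law F
  have hup : Measurable fun ω => ULift.up.{uS} (T ω) := measurable_up.comp hT
  have hdown : Measurable fun s : μ.Msg => ((ULift.down s : I) : ℝ) :=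
    measurable_subtype_coe.comp measurable_down
  have hpm : Measurable fun s : μ.Msg => (μ.posteriorMean F s : ℝ) :=
    measurable_subtype_coe.comp (μ.measurable_posteriorMean F)
  have hI : ∀ {X : μ.Msg → I}, Measurable (fun s => (X s : ℝ)) →
      Integrable (fun s => (X s : ℝ)) (μ.law F) := fun {X} hX =>
    Integrable.of_bound hX.aestronglyMeasurable 1 (.of_forall fun s => by
      rw [Real.norm_eq_abs, abs_of_nonneg (X s).2.1]; exact (X s).2.2)
  have key := Integrable.ae_eq_of_forall_setIntegral_eq (μ := μ.law F) _ _ (hI hpm) (hI hdown) ?_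
  · filter_upwards [key] with s hs using Subtype.ext hs
  intro S hS _
  have hS' : MeasurableSet (ULift.up.{uS} (α := I) ⁻¹' S) := measurable_up hS
  have hmeas : Measurable fun x : μ.Msg × I => S.indicator (fun _ => (1 : ℝ)) x.1 * (x.2 : ℝ) :=
    ((measurable_const.indicator hS).comp measurable_fst).mul
      (measurable_subtype_coe.comp measurable_snd)
  calc ∫ s in S, (μ.posteriorMean F s : ℝ) ∂(μ.law F)
      = ∫ s, ∫ ω, S.indicator (fun _ => (1 : ℝ)) s * (ω : ℝ) ∂(μ.belief F s) ∂(μ.law F) := by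
        rw [← integral_indicator hS]
        congr 1; ext s
        rw [integral_const_mul]
        by_cases hs : s ∈ S <;> simp [hs, coe_posteriorMean, expect]
    _ = ∫ ω, ∫ s, S.indicator (fun _ => (1 : ℝ)) s * (ω : ℝ) ∂(μ.kernel ω) ∂F := by
        refine μ.integral_integral_belief F hmeas (B := 1) fun x => ?_
        rw [abs_mul, abs_of_nonneg x.2.2.1]
        by_cases hs : x.1 ∈ S
        · simpa [hs] using x.2.2.2
        · simp [hs]
    _ = ∫ ω, S.indicator (fun _ => (1 : ℝ)) (ULift.up (T ω)) * (ω : ℝ) ∂F := by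
        congr 1; ext ω
        rw [integral_mul_const]
        congr 1
        exact integral_dirac' _ _ (measurable_const.indicator hS).stronglyMeasurable
    _ = ∫ ω in T ⁻¹' (ULift.up.{uS} ⁻¹' S), (ω : ℝ) ∂F := by
        rw [← integral_indicator (hT hS')]
        congr 1; ext ω
        by_cases hs : ULift.up (T ω) ∈ S <;> simp [hs]
    _ = ∫ m in ULift.up.{uS} ⁻¹' S, (m : ℝ) ∂(F.map T) := by
        have : IsProbabilityMeasure (F.map T) := Measure.isProbabilityMeasure_map hT.aemeasurable
        have h := congrArg (fun ν => ν (ULift.up.{uS} (α := I) ⁻¹' S)) hT'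
        rw [Measure.map_apply hT hS', firstMoment_apply F (hT hS'), firstMoment_apply _ hS',
          ENNReal.ofReal_eq_ofReal_iff (setIntegral_coe_nonneg _ _) (setIntegral_coe_nonneg _ _)]
          at h
        exact h
    _ = ∫ ω in T ⁻¹' (ULift.up.{uS} ⁻¹' S), (T ω : ℝ) ∂F :=
        setIntegral_map hS' measurable_subtype_coe.aestronglyMeasurable hT.aemeasurable
    _ = ∫ s in S, ((ULift.down s : I) : ℝ) ∂(μ.law F) := by
        have hlaw : μ.law F = F.map fun ω => ULift.up.{uS} (T ω) := law_ofMap F hT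
        rw [hlaw]
        exact (setIntegral_map hS hdown.aestronglyMeasurable hup.aemeasurable).symm

lemma meanLaw_ofMap (hT' : (firstMoment F).map T = firstMoment (F.map T)) :
    (ofMap.{uS} T hT).meanLaw F = F.map T := by
  rw [meanLaw, Measure.map_congr (posteriorMean_ofMap_ae F hT hT'), law_ofMap]
  exact Measure.map_map measurable_down (measurable_up.comp hT)

lemma isPartitional_ofMap :
    (ofMap.{uS} T hT).IsPartitional fun s => T ⁻¹' {s.down} where
  standardBorel := inferInstanceAs (StandardBorelSpace (ULift.{uS} I))
  disjoint := fun s t hst => Set.disjoint_left.2 fun ω hs ht =>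
    hst (ULift.ext _ _ ((show T ω = s.down from hs).symm.trans ht))
  cover := Set.eq_univ_of_forall fun ω => Set.mem_iUnion.2 ⟨ULift.up (T ω), rfl⟩
  kernel_singleton := fun s ω => by
    have hs : MeasurableSet ({s} : Set (ULift.{uS} I)) := by
      have : ({s} : Set (ULift.{uS} I)) = ULift.down ⁻¹' {s.down} := by
        ext t; exact ⟨fun h => congrArg _ h, fun h => ULift.ext _ _ h⟩
      rw [this]; exact measurable_down (measurableSet_singleton _)
    refine (Kernel.deterministic_apply' (measurable_up.comp hT) ω hs).trans ?_
    by_cases h : T ω = s.down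
    · have h' : ULift.up (T ω) ∈ ({s} : Set (ULift.{uS} I)) := ULift.ext _ _ h
      exact (Set.indicator_of_mem h' _).trans
        (Set.indicator_of_mem (show ω ∈ T ⁻¹' {s.down} from h) fun _ => (1 : ℝ≥0∞)).symm
    · have h' : ULift.up (T ω) ∉ ({s} : Set (ULift.{uS} I)) := fun h' =>
        h (congrArg ULift.down h')
      exact (Set.indicator_of_notMem h' _).trans
        (Set.indicator_of_notMem (show ω ∉ T ⁻¹' {s.down} from h) fun _ => (1 : ℝ≥0∞)).symm

end Signal

end Persuasion

open Persuasion in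
theorem theorem1 {A : Type uA} [TopologicalSpace A] [CompactSpace A] [Nonempty A] {n : ℕ}
    (f : I → ℝ≥0) (hf : Measurable f)
    (F : Measure I) [IsProbabilityMeasure F]
    (hF : F = (volume : Measure I).withDensity fun ω => (f ω : ℝ≥0∞))
    (g : Fin n → ℝ) (hg_pos : ∀ θ, 0 < g θ) (hg_sum : ∑ θ, g θ = 1)
    (u v : A → I → Fin n → ℝ)
    (hu : Persuasion.QuasiLinear u) (hv : Persuasion.QuasiLinear v) :
    ∃ (M : Set Persuasion.Signal.{uS}) (τ : Persuasion.Strategy.{uA, uS} A n),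
      Persuasion.IsOptimalMechanism F g u v M τ ∧
      M = Set.range τ.signal ∧
      ∀ θ, ∃ P : (τ.signal θ).Msg → Set I,
        (τ.signal θ).IsPartitional P ∧ Persuasion.IsLaminar P ∧
        ∃ J : ℕ → Set I,
          (∀ k, (J k).OrdConnected) ∧
          (∀ ω, ω ∉ ⋃ k, J k → Persuasion.cell P ω = {ω}) ∧
          (∀ k, ∀ ω ∈ J k, Persuasion.cell P ω ⊆ J k ∧
            {s | (P s ∩ J k).Nonempty}.encard ≤ n + 2) := by
  obtain ⟨u₁, u₂, hu₁, hu₂, hu⟩ := hu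
  obtain ⟨v₁, v₂, hv₁, hv₂, hv⟩ := hv
  have hatom : NullSingletonClass F := ⟨fun x => by
    rw [hF]; exact withDensity_absolutelyContinuous _ _ (measure_singleton x)⟩
  -- `α θ m` is the action of type `θ` at posterior mean `m`, `W θ k` tends to the designer's payoff
  -- from above
  choose α W hα hmu₁ hmu₂ hmv₁ hmv₂ hW hWle using fun θ =>
    exists_measurable_argmax (hu₁ θ) (hu₂ θ) (hv₁ θ) (hv₂ θ)
  set U : Fin n → I → ℝ := fun θ m => sSup ((fun a => u₁ a θ * (m : ℝ) + u₂ a θ) '' Set.univ)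
    with hU
  have hUc : ∀ θ, Continuous (U θ) := fun θ =>
    continuous_sSup_image_univ (f := fun (m : I) a => u₁ a θ * (m : ℝ) + u₂ a θ) (by
      have := hu₁ θ; have := hu₂ θ
      simp only [Function.uncurry_def]; fun_prop)
  have hvalue : ∀ θ (μ : Signal.{uS}), μ.value F (fun b ω => u b ω θ) =
      ∫ m, U θ m ∂(μ.meanLaw F) := fun θ μ =>
    μ.value_eq F (fun a ω => hu a ω θ) (hUc θ).measurable
  have hexpu : ∀ (μ : Signal.{uS}) b θ s, μ.expect F (fun ω => u b ω θ) s =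
      u₁ b θ * μ.posteriorMean F s + u₂ b θ := fun μ b θ s => by
    simp only [hu]; exact μ.expect_affine F _ _ s
  have hexpv : ∀ (μ : Signal.{uS}) b θ s, μ.expect F (fun ω => v b ω θ) s =
      v₁ b θ * μ.posteriorMean F s + v₂ b θ := fun μ b θ s => by
    simp only [hv]; exact μ.expect_affine F _ _ s
  obtain ⟨G, ⟨hGord, hGic⟩, hGmax, hGgap⟩ :=
    exists_optimal_extremal F g (fun θ => (hg_pos θ).le) U _ W hUc hW
  choose T hT hTmap hTmom hTsep J hJo hJout hJin using fun θ =>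
    (hGord θ).exists_partition_map (N := n + 2) (by omega) (hGgap θ)
  have hTmom' : ∀ θ, (firstMoment F).map (T θ) = firstMoment (F.map (T θ)) := fun θ => by
    rw [hTmap]; exact hTmom θ
  set τ : Strategy.{uA, uS} A n :=
    { signal := fun θ => Signal.ofMap (T θ) (hT θ)
      action := fun θ s => α θ s.down } with hτ
  have hmean : ∀ θ, (τ.signal θ).meanLaw F = G θ := fun θ =>
    (Signal.meanLaw_ofMap F (hT θ) (hTmom' θ)).trans (hTmap θ)
  have hpost : ∀ θ, ∀ᵐ s ∂((τ.signal θ).law F),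
      ((τ.signal θ).posteriorMean F s : ℝ) = (ULift.down s : I) := fun θ => by
    filter_upwards [Signal.posteriorMean_ofMap_ae F (hT θ) (hTmom' θ)] with s hs
    exact congrArg Subtype.val hs
  have hpay : designerPayoff F g v τ =
      ∑ θ, g θ * ∫ m, (v₁ (α θ m) θ * (m : ℝ) + v₂ (α θ m) θ) ∂(G θ : Measure I) := by
    refine Finset.sum_congr rfl fun θ _ => ?_
    rw [← hmean θ, Signal.integral_meanLaw _ _ (hW θ).measurable]
    congr 1
    refine integral_congr_ae ?_
    filter_upwards [Signal.posteriorMean_ofMap_ae F (hT θ) (hTmom' θ)] with s hs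
    rw [hexpv]
    change v₁ (α θ s.down) θ * _ + _ = _
    rw [show (τ.signal θ).posteriorMean F s = s.down from hs]
  refine ⟨Set.range τ.signal, τ, ⟨⟨?_, ?_, fun θ => ⟨θ, rfl⟩, ?_, ?_⟩, ?_⟩, rfl, ?_⟩
  · intro θ ω
    simp only [hu]
    exact (((hmu₁ θ).comp measurable_down).mul_const _).add ((hmu₂ θ).comp measurable_down)
  · intro θ ω
    simp only [hv]
    exact (((hmv₁ θ).comp measurable_down).mul_const _).add ((hmv₂ θ).comp measurable_down)
  · intro θ
    filter_upwards [hpost θ] with s hs b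
    rw [hexpu, hexpu, hs]
    exact hα θ s.down b
  · rintro θ _ ⟨θ', rfl⟩
    rw [hvalue, hvalue, hmean, hmean]
    exact hGic θ θ'
  -- the laws of posterior means that another optimal strategy induces are feasible, and its actions
  -- are worth at most `W θ k` to the designer, for every `k`
  · intro M' τ' hτ'
    set G' : Fin n → ProbabilityMeasure I := fun θ =>
      ⟨(τ'.signal θ).meanLaw F, inferInstance⟩ with hG'
    have hG'f : G' ∈ feasibleSet F U := by
      refine ⟨fun θ => (τ'.signal θ).convexOrder_meanLaw F, fun θ θ' => ?_⟩
      have := hτ'.opt_signal θ _ (hτ'.mem θ')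
      rwa [hvalue, hvalue] at this
    rw [hpay]
    refine le_trans (Finset.sum_le_sum fun θ _ => ?_) (hGmax G' hG'f)
    refine mul_le_mul_of_nonneg_left ?_ (hg_pos θ).le
    refine ge_of_tendsto ((hW θ).tendsto_integral (G' θ : Measure I)) (.of_forall fun k => ?_)
    have hWm := ((hW θ).continuous k).measurable
    rw [show (G' θ : Measure I) = (τ'.signal θ).meanLaw F from rfl,
      (τ'.signal θ).integral_meanLaw F hWm]
    refine integral_mono_ae ?_ ?_ ?_
    · have hm₂ : Measurable fun s => v₂ (τ'.action θ s) θ := by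
        simpa [hv] using hτ'.measurable_v θ 0
      have hm₁ : Measurable fun s => v₁ (τ'.action θ s) θ := by
        have := (hτ'.measurable_v θ 1).sub hm₂
        simpa [hv, Pi.sub_def] using this
      obtain ⟨B₁, hB₁⟩ := isCompact_univ.exists_bound_of_continuousOn (hv₁ θ).continuousOn
      obtain ⟨B₂, hB₂⟩ := isCompact_univ.exists_bound_of_continuousOn (hv₂ θ).continuousOn
      simp only [hexpv]
      refine Integrable.of_bound (C := B₁ + B₂) (Measurable.aestronglyMeasurable ?_)
        (.of_forall fun s => ?_)
      · exact (hm₁.mul (measurable_subtype_coe.comp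
          ((τ'.signal θ).measurable_posteriorMean F))).add hm₂
      · refine (norm_add_le _ _).trans (add_le_add ?_ (hB₂ _ (Set.mem_univ _)))
        rw [norm_mul, Real.norm_of_nonneg ((τ'.signal θ).posteriorMean F s).2.1]
        exact (mul_le_of_le_one_right (norm_nonneg _) ((τ'.signal θ).posteriorMean F s).2.2).trans
          (hB₁ _ (Set.mem_univ _))
    · obtain ⟨B, hB⟩ := (hW θ).bdd
      exact Integrable.of_bound
        (hWm.comp ((τ'.signal θ).measurable_posteriorMean F)).aestronglyMeasurable B
        (.of_forall fun s => hB k _)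
    · filter_upwards [hτ'.opt_act θ] with s hs
      simp only [hexpu] at hs
      rw [hexpv]
      exact hWle θ _ _ hs k
  · intro θ
    refine ⟨fun s => T θ ⁻¹' {s.down}, Signal.isPartitional_ofMap (hT θ), fun s t => ?_, J θ,
      hJo θ, fun ω hω => ?_, fun k ω hω => ⟨?_, ?_⟩⟩
    · by_cases hst : s.down = t.down
      · simp [hst]
      · exact (hTsep θ hst).cx_inter
    · ext ω'
      rw [Set.mem_singleton_iff, ← hJout θ ω hω ω']
      constructor
      · rintro ⟨s, hs, hs'⟩
        exact (show T θ ω' = s.down from hs').trans (show T θ ω = s.down from hs).symm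
      · exact fun h => ⟨ULift.up (T θ ω), rfl, h⟩
    · rintro ω' ⟨s, hs, hs'⟩
      exact (hJin θ k).1 ω hω ω'
        ((show T θ ω' = s.down from hs').trans (show T θ ω = s.down from hs).symm)
    · refine le_trans ?_ ((hJin θ k).2.trans (by norm_num))
      have hsub : {s : (τ.signal θ).Msg | ((T θ ⁻¹' {ULift.down s}) ∩ J θ k).Nonempty} ⊆
          (fun m => (ULift.up m : ULift.{uS} I)) '' (T θ '' J θ k) := by
        rintro s ⟨ω', hs, hω'⟩
        exact ⟨T θ ω', ⟨ω', hω', rfl⟩, ULift.ext _ _ hs⟩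
      exact (Set.encard_le_encard hsub).trans (Set.encard_image_le _ _)
end
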